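/- A \emph{CTKT graph} (vacuum Feynman graph of the quartic $O(N)^3$ tensor model) is a finite graph with four-valent vertices (closed edges without vertices, called rings, are allowed), whose edges carry three strands of colors $1,2,3$. Inside a vertex with half-edges $A,B,C,D$ the strands of each color join the half-edges in two pairs: at a \emph{tetrahedral} vertex the three colors join $AB|CD$, $AC|BD$, $AD|BC$; at a \emph{pillow} vertex of special color $j$ the color $j$ joins $AC|BD$ and the two other colors join $AB|CD$; at a \emph{double trace} vertex all the colors join $AB|CD$. Edges join strands of equal color; the closed strands are the \emph{faces}, and the length of a face is the number of its edge strands. A graph is connected if it is connected as an ordinary graph, each vertex (also a double trace) being a single vertex. The \emph{refinement} $\tilde{\mathcal G}$ of $\mathcal G$ is the graph with only tetrahedral vertices obtained by replacing every pillow of special color $c$ by two tetrahedral vertices, one carrying $A,C$ and the other $B,D$, joined by two edges that bound a face of color $c$ and length $2$ and such that the external strands are those of the pillow; and every double trace by a chain of two so resolved pillows of distinct special colors $i\neq j$, the half-edges $C,D$ of the first being joined to $A,B$ of the second (the ordered pair $(i,j)$ may be chosen arbitrarily and independently at each double trace vertex). For $i\in\{1,2,3\}$ the \emph{jacket} $\mathcal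 J^i$ is the ribbon graph obtained from $\tilde{\mathcal G}$ by erasing the faces of color $i$. The non-orientable genus $k$ of a connected ribbon graph is defined by $V-E+F=2-k$ (a ring counts with $V-E=0$ and $F=2$), and the \emph{CTKT degree} is $\omega(\mathcal G)=\frac12\sum_{i=1}^3 k(\mathcal J^i)$. A graph with only tetrahedral vertices is \emph{melonic} if it is obtained from the ring graph (a single ring) by iteratively inserting, on arbitrary edges, two tetrahedral vertices joined by three parallel edges any two of which bound a face of length $2$. A connected CTKT graph is a \emph{melon-tadpole graph} if its refinement is melonic. \textbf{Proposition.} Let $\mathcal G$ be a connected CTKT graph and $\tilde{\mathcal G}$ any refinement of it. Then $\omega(\mathcal G)=0$ if and only if $\mathcal G$ is a melon-tadpole graph, that is, $\tilde{\mathcal G}$ is melonic. Moreover, if $\omega(\mathcal G)=0$, then $\tilde{\mathcal G}$ has no face of length $1$ and no face of length $3$. -/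

import Mathlib

universe u

namespace CTKT

/-- The three vertices of the quartic `O(N)^3` model; the pillow carries its special colour. -/
inductive VertexKind where
  | tetra
  | pillow (c : Fin 3)
  | double

/-- The three perfect matchings of the four half-edges `A, B, C, D = 0, 1, 2, 3` of a vertex:
`AB|CD`, `AC|BD`, `AD|BC`. -/
def matching : Fin 3 → Equiv.Perm (Fin 4) :=
  ![Equiv.swap 0 1 * Equiv.swap 2 3, Equiv.swap 0 2 * Equiv.swap 1 3,
    Equiv.swap 0 3 * Equiv.swap 1 2]

/-- How the strands of colour `c` join the half-edges `A, B, C, D` inside a vertex.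
* tetrahedron: the three colours realise the three matchings;
* pillow of special colour `j`: colour `j` joins `AC|BD`, the two others `AB|CD`;
* double trace: all the colours join `AB|CD`. -/
def VertexKind.strand : VertexKind → Fin 3 → Equiv.Perm (Fin 4)
  | .tetra, c => matching c
  | .pillow j, c => if c = j then matching 1 else matching 0
  | .double, _ => matching 0

theorem matching_matching : ∀ (c : Fin 3) (i : Fin 4), matching c (matching c i) = i := by decide

theorem matching_ne : ∀ (c : Fin 3) (i : Fin 4), matching c i ≠ i := by decide

theorem VertexKind.strand_eq (κ : VertexKind) (c : Fin 3) : ∃ d, κ.strand c = matching d := by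
  cases κ with
  | tetra => exact ⟨c, rfl⟩
  | pillow j =>
    by_cases h : c = j
    · exact ⟨1, if_pos h⟩
    · exact ⟨0, if_neg h⟩
  | double => exact ⟨0, rfl⟩

theorem VertexKind.strand_strand (κ : VertexKind) (c : Fin 3) (i : Fin 4) :
    κ.strand c (κ.strand c i) = i := by
  obtain ⟨d, hd⟩ := κ.strand_eq c
  rw [hd, matching_matching]

theorem VertexKind.strand_ne (κ : VertexKind) (c : Fin 3) (i : Fin 4) : κ.strand c i ≠ i := by
  obtain ⟨d, hd⟩ := κ.strand_eq c
  rw [hd]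
  exact matching_ne d i

/-- A (vacuum) Feynman graph of the model: finitely many four-valent stranded vertices, whose
half-edges `(v, i)` are paired into edges by a fixed-point free involution, together with a number
of rings (edges closing onto themselves without any vertex). An edge joins the strands of equal
colour of its two half-edges. -/
structure Graph where
  V : Type u
  finite : Finite V
  kind : V → VertexKind
  edge : V × Fin 4 → V × Fin 4
  edge_edge : ∀ x, edge (edge x) = x
  edge_ne : ∀ x, edge x ≠ x
  rings : ℕ

namespace Graph

/-- The half-edge joined to `x`, inside its vertex, by the strand of colour `c`. -/
def corner (G : Graph.{u}) (c : Fin 3) (x : G.V × Fin 4) : G.V × Fin 4 :=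
  (x.1, (G.kind x.1).strand c x.2)

/-- The connected components, every vertex (also a double trace) holding its four half-edges
together. -/
noncomputable def numComponents (G : Graph.{u}) : ℕ :=
  Nat.card (Quot fun v w : G.V => ∃ i j : Fin 4, G.edge (v, i) = (w, j)) + G.rings

def Connected (G : Graph.{u}) : Prop := G.numComponents = 1

/-- The faces of colour `c` that visit at least one vertex: the closed strands of colour `c`. -/
def Face (G : Graph.{u}) (c : Fin 3) : Type u :=
  Quot fun x y : G.V × Fin 4 => G.corner c x = y ∨ G.edge x = y

/-- The length of a face: the number of edge strands (equivalently, of corners) it is made of. Each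
of them has two ends, and each half-edge has one end of colour `c`. -/
noncomputable def faceLength (G : Graph.{u}) (c : Fin 3) (f : G.Face c) : ℕ :=
  Nat.card {x : G.V × Fin 4 // (Quot.mk _ x : G.Face c) = f} / 2

/-- Isomorphisms of stranded graphs: the half-edges of a vertex can be relabelled in any way that
respects the coloured strands. -/
def Iso (G G' : Graph.{u}) : Prop :=
  ∃ (φ : G.V ≃ G'.V) (ψ : G.V × Fin 4 ≃ G'.V × Fin 4),
    (∀ x, (ψ x).1 = φ x.1) ∧ (∀ v, G'.kind (φ v) = G.kind v) ∧
    (∀ x, ψ (G.edge x) = G'.edge (ψ x)) ∧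
    (∀ c x, ψ (G.corner c x) = G'.corner c (ψ x)) ∧ G.rings = G'.rings

end Graph

/-! ### Ribbon graphs -/

/-- A ribbon graph (orientable or not), as a combinatorial map: a flag is one side of one half-edge.
`side` passes to the other side of the same half-edge, `corner` turns to the neighbouring half-edge
of the vertex along the corner on this side, `edge` follows the side of the edge to its
other end. `rings` counts the closed ribbon edges without vertices. -/
structure RibbonGraph where
  Flag : Type u
  finite : Finite Flag
  side : Flag → Flag
  corner : Flag → Flag
  edge : Flag → Flag
  side_side : ∀ x, side (side x) = x
  corner_corner : ∀ x, corner (corner x) = x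
  edge_edge : ∀ x, edge (edge x) = x
  side_ne : ∀ x, side x ≠ x
  corner_ne : ∀ x, corner x ≠ x
  edge_ne : ∀ x, edge x ≠ x
  side_edge : ∀ x, side (edge x) = edge (side x)
  side_edge_ne : ∀ x, side (edge x) ≠ x
  rings : ℕ

namespace RibbonGraph

noncomputable def numVertices (R : RibbonGraph.{u}) : ℕ :=
  Nat.card (Quot fun x y : R.Flag => R.side x = y ∨ R.corner x = y)

/-- The edges that have end vertices. -/
noncomputable def numEdges (R : RibbonGraph.{u}) : ℕ :=
  Nat.card (Quot fun x y : R.Flag => R.side x = y ∨ R.edge x = y)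

/-- The closed strands; a ring has two of them. -/
noncomputable def numFaces (R : RibbonGraph.{u}) : ℕ :=
  Nat.card (Quot fun x y : R.Flag => R.corner x = y ∨ R.edge x = y) + 2 * R.rings

noncomputable def numComponents (R : RibbonGraph.{u}) : ℕ :=
  Nat.card (Quot fun x y : R.Flag => R.side x = y ∨ R.corner x = y ∨ R.edge x = y) + R.rings

/-- A ring, being a circle, contributes `0` to the difference of vertices and edges. -/
noncomputable def eulerChar (R : RibbonGraph.{u}) : ℤ :=
  (R.numVertices : ℤ) - R.numEdges + R.numFaces

/-- The non-orientable genus `k`: `V - E + F = 2 - k` on a connected ribbon graph, and the sum over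
the components in general. -/
noncomputable def genus (R : RibbonGraph.{u}) : ℤ := 2 * R.numComponents - R.eulerChar

end RibbonGraph

/-- The colour different from the two distinct colours `i` and `c`. -/
def third (i c : Fin 3) : Fin 3 := -(i + c)

theorem third_ne : ∀ i c : Fin 3, c ≠ i → third i c ≠ i := by decide

theorem third_ne_right : ∀ i c : Fin 3, c ≠ i → third i c ≠ c := by decide

theorem third_third : ∀ i c : Fin 3, third i (third i c) = c := by decide

/-- The jacket obtained by erasing the faces of colour `i`: the strands of the two other colours are
the two sides of the ribbons. It is used for graphs with only tetrahedral vertices, whose half-edges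
are cyclically ordered by the corners of the two remaining colours. -/
def Graph.jacket (G : Graph.{u}) (i : Fin 3) : RibbonGraph.{u} where
  Flag := (G.V × Fin 4) × {c : Fin 3 // c ≠ i}
  finite := by
    have := G.finite
    infer_instance
  side x := (x.1, ⟨third i x.2.1, third_ne i _ x.2.2⟩)
  corner x := (G.corner x.2.1 x.1, x.2)
  edge x := (G.edge x.1, x.2)
  side_side x := Prod.ext rfl (Subtype.ext (third_third i x.2.1))
  corner_corner x := by simp [Graph.corner, VertexKind.strand_strand]
  edge_edge x := by simp [G.edge_edge]
  side_ne x h := third_ne_right i x.2.1 x.2.2 (congrArg (fun y => y.2.1) h)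
  corner_ne x h := VertexKind.strand_ne _ _ _ (congrArg (fun y => y.1.2) h)
  edge_ne x h := G.edge_ne x.1 (congrArg Prod.fst h)
  side_edge _ := rfl
  side_edge_ne x h := third_ne_right i x.2.1 x.2.2 (congrArg (fun y => y.2.1) h)
  rings := G.rings

/-! ### Refinement -/

/-- Number of tetrahedra in the minimal resolution of a vertex. -/
def VertexKind.size : VertexKind → ℕ
  | .tetra => 1
  | .pillow _ => 2
  | .double => 4

/-- An ordered pair of distinct colours. The minimal resolutions of a double trace are indexed by
these pairs. -/
abbrev ColorPair := {p : Fin 3 × Fin 3 // p.1 ≠ p.2}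

/-- The half-edge (tetrahedron, label) of the minimal resolution of a vertex that carries the
external half-edge `A, B, C, D = 0, 1, 2, 3` of the vertex. The label `c.succ` is joined
to the label `0` by the strand of colour `c` of a tetrahedron. -/
def VertexKind.leg (p : ColorPair) : (κ : VertexKind) → Fin 4 → Fin κ.size × Fin 4
  | .tetra => fun a => ((0 : Fin 1), a)
  | .pillow c => ![((0 : Fin 2), 0), ((1 : Fin 2), 0), ((0 : Fin 2), c.succ), ((1 : Fin 2), c.succ)]
  | .double => ![((0 : Fin 4), 0), ((1 : Fin 4), 0), ((2 : Fin 4), p.1.2.succ),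
      ((3 : Fin 4), p.1.2.succ)]

/-- What a half-edge of the minimal resolution is joined to: an external half-edge of the resolved
vertex (`Sum.inl`), or another half-edge of the resolution (`Sum.inr`).
* pillow of special colour `c`: two tetrahedra `0`, `1` joined by the two edges that bound
  a face of colour `c`, with `A`, `C` on the tetrahedron `0` and `B`, `D` on `1`;
* double trace: the resolution of the pillow of special colour `p.1.1`, on the tetrahedra `0`, `1`,
  in a chain with the resolution of the pillow of special colour `p.1.2`, on the tetrahedra `2`,
  `3`; the half-edges `C`, `D` of the first are joined to `A`, `B` of the second. -/
def VertexKind.slot (p : ColorPair) :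
    (κ : VertexKind) → Fin κ.size × Fin 4 → Fin 4 ⊕ (Fin κ.size × Fin 4)
  | .tetra => fun x => Sum.inl x.2
  | .pillow c => fun x : Fin 2 × Fin 4 =>
      if x.2 = 0 then Sum.inl (![0, 1] x.1)
      else if x.2 = c.succ then Sum.inl (![2, 3] x.1)
      else Sum.inr ((![1, 0] x.1 : Fin 2), x.2)
  | .double => fun x : Fin 4 × Fin 4 =>
      if x.1 < 2 then
        if x.2 = 0 then Sum.inl x.1
        else if x.2 = p.1.1.succ then Sum.inr ((![2, 3, 0, 1] x.1 : Fin 4), (0 : Fin 4))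
        else Sum.inr ((![1, 0, 3, 2] x.1 : Fin 4), x.2)
      else
        if x.2 = 0 then Sum.inr ((![2, 3, 0, 1] x.1 : Fin 4), p.1.1.succ)
        else if x.2 = p.1.2.succ then Sum.inl x.1
        else Sum.inr ((![1, 0, 3, 2] x.1 : Fin 4), x.2)

theorem VertexKind.slot_leg (p : ColorPair) (κ : VertexKind) (a : Fin 4) :
    κ.slot p (κ.leg p a) = Sum.inl a := by
  cases κ with
  | tetra => rfl
  | pillow c => revert a c p; simp only [slot, leg]; decide
  | double => revert a p; simp only [slot, leg]; decide

theorem VertexKind.leg_of_slot (p : ColorPair) (κ : VertexKind) (x : Fin κ.size × Fin 4)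
    (a : Fin 4) (h : κ.slot p x = Sum.inl a) : κ.leg p a = x := by
  cases κ with
  | tetra =>
    obtain ⟨s, l⟩ := x
    have : l = a := by simpa [slot] using h
    subst this
    exact Prod.ext (Subsingleton.elim (α := Fin 1) _ _) rfl
  | pillow c =>
    revert h a x c; simp only [slot, leg, size]; decide
  | double =>
    revert h a x p; simp only [slot, leg, size]; decide

theorem VertexKind.slot_inr (p : ColorPair) (κ : VertexKind) (x y : Fin κ.size × Fin 4)
    (h : κ.slot p x = Sum.inr y) : κ.slot p y = Sum.inr x ∧ y ≠ x := by
  cases κ with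
  | tetra => simp [slot] at h
  | pillow c => revert h y x c; simp only [slot, size]; decide
  | double =>
    obtain ⟨⟨p, q⟩, hpq⟩ := p
    revert h y x p q; simp only [slot, size]; decide

namespace Graph

/-- The half-edge `l` of the resolution of the vertex `v`, as a half-edge of the refined graph. -/
def attach (G : Graph.{u}) (v : G.V) (l : Fin (G.kind v).size × Fin 4) :
    (Σ v, Fin (G.kind v).size) × Fin 4 :=
  (⟨v, l.1⟩, l.2)

/-- The half-edge of the refined graph that carries the half-edge `y` of `G`. -/
def outer (G : Graph.{u}) (r : G.V → ColorPair) (y : G.V × Fin 4) :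
    (Σ v, Fin (G.kind v).size) × Fin 4 :=
  G.attach y.1 ((G.kind y.1).leg (r y.1) y.2)

/-- The pairing of the half-edges of the refined graph: the edges of `G`, and the internal edges of
the resolutions. -/
def refineEdge (G : Graph.{u}) (r : G.V → ColorPair)
    (x : (Σ v, Fin (G.kind v).size) × Fin 4) : (Σ v, Fin (G.kind v).size) × Fin 4 :=
  Sum.elim (fun a => G.outer r (G.edge (x.1.1, a))) (fun l => G.attach x.1.1 l)
    ((G.kind x.1.1).slot (r x.1.1) (x.1.2, x.2))

theorem attach_injective (G : Graph.{u}) (v : G.V) : Function.Injective (G.attach v) := by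
  intro l m h
  obtain ⟨h1, h2⟩ := Prod.mk.inj h
  exact Prod.ext (eq_of_heq (Sigma.mk.inj h1).2) h2

theorem outer_injective (G : Graph.{u}) (r : G.V → ColorPair) :
    Function.Injective (G.outer r) := by
  rintro ⟨v, a⟩ ⟨w, b⟩ h
  obtain rfl : v = w := congrArg (fun x => x.1.1) h
  have h1 := congrArg ((G.kind v).slot (r v)) (G.attach_injective v h)
  rw [VertexKind.slot_leg, VertexKind.slot_leg] at h1
  exact Prod.ext rfl (Sum.inl.inj h1)

theorem refineEdge_outer (G : Graph.{u}) (r : G.V → ColorPair) (y : G.V × Fin 4) :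
    G.refineEdge r (G.outer r y) = G.outer r (G.edge y) := by
  simp [refineEdge, outer, attach, VertexKind.slot_leg]

theorem refineEdge_attach (G : Graph.{u}) (r : G.V → ColorPair) (v : G.V)
    (l m : Fin (G.kind v).size × Fin 4) (h : (G.kind v).slot (r v) l = Sum.inr m) :
    G.refineEdge r (G.attach v l) = G.attach v m := by
  simp [refineEdge, attach, h]

theorem outer_or_attach (G : Graph.{u}) (r : G.V → ColorPair)
    (x : (Σ v, Fin (G.kind v).size) × Fin 4) :
    (∃ y, x = G.outer r y) ∨
      ∃ v l m, x = G.attach v l ∧ (G.kind v).slot (r v) l = Sum.inr m := by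
  obtain ⟨⟨v, s⟩, l⟩ := x
  rcases h : (G.kind v).slot (r v) (s, l) with a | y
  · refine Or.inl ⟨(v, a), ?_⟩
    simp [outer, attach, VertexKind.leg_of_slot _ _ _ _ h]
  · exact Or.inr ⟨v, (s, l), y, rfl, h⟩

/-- The refinement of `G`: every pillow and double trace vertex is replaced by its minimal
resolution into tetrahedra, `r` choosing the resolution of each double trace. -/
def refine (G : Graph.{u}) (r : G.V → ColorPair) : Graph.{u} where
  V := Σ v, Fin (G.kind v).size
  finite := by
    have := G.finite
    infer_instance
  kind _ := .tetra
  edge := G.refineEdge r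
  edge_edge x := by
    rcases G.outer_or_attach r x with ⟨y, rfl⟩ | ⟨v, l, m, rfl, h⟩
    · rw [refineEdge_outer, refineEdge_outer, G.edge_edge]
    · rw [refineEdge_attach G r v l m h,
        refineEdge_attach G r v m l (VertexKind.slot_inr _ _ _ _ h).1]
  edge_ne x := by
    rcases G.outer_or_attach r x with ⟨y, rfl⟩ | ⟨v, l, m, rfl, h⟩
    · rw [refineEdge_outer]
      exact fun h => G.edge_ne y (G.outer_injective r h)
    · rw [refineEdge_attach G r v l m h]
      exact fun h' => (VertexKind.slot_inr _ _ _ _ h).2 (G.attach_injective v h')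
  rings := G.rings

/-- The degree: half of the sum of the non-orientable genera of the three jackets
of the refinement. -/
noncomputable def degree (G : Graph.{u}) (r : G.V → ColorPair) : ℚ :=
  (1 / 2) * ∑ i : Fin 3, (((G.refine r).jacket i).genus : ℚ)

/-! ### Melonic graphs -/

/-- The ring graph: one edge closing onto itself. -/
def ring : Graph.{u} where
  V := PEmpty
  finite := inferInstance
  kind v := v.elim
  edge x := x
  edge_edge _ := rfl
  edge_ne x := x.1.elim
  rings := 1

open Classical in
/-- Insertion of two tetrahedra, joined by three parallel edges, on the edge `{h, G.edge h}`. The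
parallel edges join equal labels, so that any two of them bound a face of length two. -/
noncomputable def insertEdge (G : Graph.{u}) (h : G.V × Fin 4) : Graph.{u} where
  V := G.V ⊕ Bool
  finite := by
    have := G.finite
    infer_instance
  kind := Sum.elim G.kind fun _ => .tetra
  edge
    | (.inl v, i) =>
        if (v, i) = h then (.inr false, 0)
        else if (v, i) = G.edge h then (.inr true, 0)
        else (.inl (G.edge (v, i)).1, (G.edge (v, i)).2)
    | (.inr b, i) =>
        if i = 0 then
          if b then (.inl (G.edge h).1, (G.edge h).2) else (.inl h.1, h.2)
        else (.inr (!b), i)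
  edge_edge := by
    rintro ⟨v | b, i⟩
    · by_cases h1 : (v, i) = h
      · subst h1; simp
      · by_cases h2 : (v, i) = G.edge h
        · simp [← h2, h1]
        · have h3 : G.edge (v, i) ≠ h := fun h3 => h2 (by rw [← h3, G.edge_edge])
          have h4 : G.edge (v, i) ≠ G.edge h := fun h4 =>
            h1 (by rw [← G.edge_edge (v, i), h4, G.edge_edge])
          simp [h1, h2, h3, h4, G.edge_edge]
    · by_cases hi : i = 0
      · subst hi
        cases b
        · simp
        · simp [G.edge_ne h]
      · simp [hi]
  edge_ne := by
    rintro ⟨v | b, i⟩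
    · by_cases h1 : (v, i) = h
      · simp [h1]
      · by_cases h2 : (v, i) = G.edge h
        · simp [h2, G.edge_ne h]
        · have := G.edge_ne (v, i)
          simp only [h1, h2, if_false, ne_eq]
          intro h3
          refine this (Prod.ext ?_ ?_)
          · exact Sum.inl.inj (congrArg Prod.fst h3)
          · exact (Prod.mk.inj h3).2
    · by_cases hi : i = 0
      · cases b <;> simp [hi]
      · cases b <;> simp [hi]
  rings := G.rings

/-- Insertion of two tetrahedra, joined by three parallel edges, on a ring (when there is one): the
ring becomes a fourth edge between the new vertices. -/
def insertRing (G : Graph.{u}) : Graph.{u} where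
  V := G.V ⊕ Bool
  finite := by
    have := G.finite
    infer_instance
  kind := Sum.elim G.kind fun _ => .tetra
  edge
    | (.inl v, i) => (.inl (G.edge (v, i)).1, (G.edge (v, i)).2)
    | (.inr b, i) => (.inr (!b), i)
  edge_edge := by
    rintro ⟨v | b, i⟩
    · simp [G.edge_edge]
    · simp
  edge_ne := by
    rintro ⟨v | b, i⟩
    · intro h
      refine G.edge_ne (v, i) (Prod.ext ?_ ?_)
      · exact Sum.inl.inj (congrArg Prod.fst h)
      · exact (Prod.mk.inj h).2
    · cases b <;> simp
  rings := G.rings - 1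

/-- Melonic graphs: the ring graph, and all graphs obtained from it by iterated insertions, on the
edges, of two tetrahedra joined by three parallel edges. -/
inductive IsMelonic : Graph.{u} → Prop
  | ring : IsMelonic Graph.ring
  | insertEdge (G : Graph.{u}) (h : G.V × Fin 4) : IsMelonic G → IsMelonic (G.insertEdge h)
  | insertRing (G : Graph.{u}) : 0 < G.rings → IsMelonic G → IsMelonic G.insertRing
  | iso (G G' : Graph.{u}) : G.Iso G' → IsMelonic G → IsMelonic G'

/-- Melon-tadpole graphs: connected graphs whose refinement is melonic. -/
def IsMelonTadpole (G : Graph.{u}) (r : G.V → ColorPair) : Prop :=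
  G.Connected ∧ (G.refine r).IsMelonic

end Graph

end CTKT

namespace CTKT

open Module

/-! ### Involutions and functions with values in the field with two elements -/

section LinearAlgebra

variable {X : Type*}

/-! Write V for the number of tetrahedra, C for the number of components that hold a vertex, and F_c
for the number of faces of colour c. Every jacket of a tetrahedral graph has 2V edges and the faces
of two colours, so twice the degree is `defect` = 6C + 3V - 2(F_0 + F_1 + F_2); rings cancel.
Inserting a melon on an edge adds two vertices and one face of each colour, and inserting one on a
ring adds a component, two vertices and two faces of each colour. Neither changes the defect, so
melonic graphs have degree zero.

The converse is an induction that removes one melon at a time; the work is to find a melon. Mod 2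
homology gives F_a + F_b ≤ V + 2 on a connected jacket (`card_face_add_card_face_le`). Defect zero
forces equality for each pair of colours, and then every mod 2 cycle of edges bounds a set of faces
of colours a and b (`range_faceBoundary_eq`). Applied to a face of colour c, which is a closed curve
on the jacket of the two other colours, this is a discrete Jordan theorem. It gives that all faces
have even length (`four_dvd_ncard_face`), which also settles the second claim, and that a face of
length two has two sides, each a set of vertices attached to the rest at two half-edges only
(`exists_regions`).

If all faces had length at least four, then F_c ≤ V/2 for each c, against F_0 + F_1 = V + 2. So a
face of length two exists. The same count works inside a nonempty region attached at two half-edges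
(`IsRegion.exists_short_face`): it contains a face of length two, one side of which is either empty
or a strictly smaller region. By descent some side is empty, and then the two vertices of that face
are joined by a third edge: they form a melon. -/

theorem finrank_fun_zmod_two (X : Type*) [Finite X] :
    finrank (ZMod 2) (X → ZMod 2) = Nat.card X := by
  have := Fintype.ofFinite X
  rw [finrank_fintype_fun_eq_card, Nat.card_eq_fintype_card]

/-- The functions that vanish outside of `A`. -/
def supportedIn (A : Set X) : Submodule (ZMod 2) (X → ZMod 2) where
  carrier := {z | ∀ x, x ∉ A → z x = 0}
  add_mem' hz hw x hx := by simp [hz x hx, hw x hx]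
  zero_mem' _ _ := rfl
  smul_mem' r z hz x hx := by simp [hz x hx]

open Classical in
theorem finrank_supportedIn [Finite X] (A : Set X) :
    finrank (ZMod 2) (supportedIn A) = Nat.card A := by
  let e : supportedIn A ≃ₗ[ZMod 2] (A → ZMod 2) :=
    { toFun := fun z a => z.1 a
      map_add' := fun _ _ => rfl
      map_smul' := fun _ _ => rfl
      invFun := fun g => ⟨fun x => if h : x ∈ A then g ⟨x, h⟩ else 0, fun x hx => dif_neg hx⟩
      left_inv := by
        rintro ⟨z, hz⟩
        ext x
        by_cases h : x ∈ A
        · simp [h]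
        · simp [h, hz x h]
      right_inv := by
        intro g
        ext ⟨x, hx⟩
        simp [hx] }
  rw [e.finrank_eq, finrank_fun_zmod_two]

/-- The functions that are invariant under `α`. -/
def invariantUnder (α : X → X) : Submodule (ZMod 2) (X → ZMod 2) where
  carrier := {z | ∀ x, z (α x) = z x}
  add_mem' hz hw x := by simp [hz x, hw x]
  zero_mem' _ := rfl
  smul_mem' r z hz x := by simp [hz x]

/-- The involution carries the part of `B` inside `s` bijectively onto the part outside. This is
used both for the corners and for the edges, to compare two ways of halving the half-edges of a
face. -/
theorem two_mul_ncard_inter [Finite X] {α : X → X} (hα : Function.Involutive α) {B : Set X}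
    (hB : ∀ x ∈ B, α x ∈ B) {s : X → Prop} (hs : ∀ x ∈ B, s (α x) ↔ ¬ s x) :
    2 * (B ∩ {x | s x}).ncard = B.ncard := by
  have h1 : α '' (B ∩ {x | s x}) = B \ {x | s x} := by
    ext y
    constructor
    · rintro ⟨x, ⟨hx, hsx⟩, rfl⟩
      refine ⟨hB x hx, ?_⟩
      exact fun h => (hs x hx).1 h hsx
    · rintro ⟨hy, hsy⟩
      exact ⟨α y, ⟨hB y hy, (hs y hy).2 hsy⟩, hα y⟩
  have h2 := Set.ncard_image_of_injective (B ∩ {x | s x}) hα.injective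
  have h3 := Set.ncard_inter_add_ncard_sdiff_eq_ncard B {x | s x} (Set.toFinite _)
  rw [h1] at h2
  omega

theorem exists_flip [Finite X] {α : X → X} (hα : Function.Involutive α) (hne : ∀ x, α x ≠ x) :
    ∃ s : X → Prop, ∀ x, s (α x) ↔ ¬ s x := by
  have := Fintype.ofFinite X
  let f := Fintype.equivFin X
  -- In an arbitrary numbering, the chosen point of each orbit is the one with the smaller number.
  refine ⟨fun x => f x < f (α x), fun x => ?_⟩
  have h : f (α x) ≠ f x := fun h => hne x (f.injective h)
  change f (α x) < f (α (α x)) ↔ ¬ f x < f (α x)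
  rw [hα x]
  constructor
  · exact fun h => not_lt_of_gt h
  · exact fun h' => lt_of_le_of_ne (not_lt.1 h') h

theorem even_ncard_of_involution [Finite X] {α : X → X} (hα : Function.Involutive α)
    (hne : ∀ x, α x ≠ x) {B : Set X} (hB : ∀ x ∈ B, α x ∈ B) : Even B.ncard := by
  obtain ⟨s, hs⟩ := exists_flip hα hne
  rw [← two_mul_ncard_inter hα hB fun x _ => hs x]
  exact even_two_mul _

/-- An invariant function is determined by its values on a set of representatives of the two-point
orbits. -/
theorem two_mul_finrank_invariantUnder_le [Finite X] {α : X → X} (hα : Function.Involutive α)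
    (hne : ∀ x, α x ≠ x) : 2 * finrank (ZMod 2) (invariantUnder α) ≤ Nat.card X := by
  obtain ⟨s, hs⟩ := exists_flip hα hne
  have h1 := two_mul_ncard_inter hα (B := Set.univ) (fun _ _ => trivial) fun x _ => hs x
  rw [Set.univ_inter, Set.ncard_univ] at h1
  let r : invariantUnder α →ₗ[ZMod 2] ({x | s x} → ZMod 2) :=
    { toFun := fun z x => z.1 x
      map_add' := fun _ _ => rfl
      map_smul' := fun _ _ => rfl }
  have hr : Function.Injective r := by
    rintro ⟨z, hz⟩ ⟨w, hw⟩ h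
    ext x
    by_cases hx : s x
    · exact congrFun h ⟨x, hx⟩
    · have := congrFun h ⟨α x, (hs x).2 hx⟩
      change z (α x) = w (α x) at this
      rwa [hz, hw] at this
  have h2 := LinearMap.finrank_le_finrank_of_injective hr
  rw [finrank_fun_zmod_two] at h2
  rw [← h1, ← Nat.card_coe_set_eq]
  omega

/-- In characteristic two, both the image and the kernel of z ↦ z + z ∘ α consist of invariant
functions, so rank-nullity on the functions supported in `A` gives the bound. -/
theorem card_le_two_mul_finrank_invariantUnder [Finite X] {α : X → X}
    (hα : Function.Involutive α) {A : Set X} (hA : ∀ x ∈ A, α x ∈ A) :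
    Nat.card A ≤ 2 * finrank (ZMod 2) ↥(invariantUnder α ⊓ supportedIn A) := by
  let φ : supportedIn A →ₗ[ZMod 2] ↥(invariantUnder α ⊓ supportedIn A) :=
    { toFun := fun z => ⟨fun x => z.1 x + z.1 (α x), by
        refine ⟨fun x => ?_, fun x hx => ?_⟩
        · change z.1 (α x) + z.1 (α (α x)) = z.1 x + z.1 (α x)
          rw [hα x, add_comm]
        · have h : α x ∉ A := fun h => hx (by have := hA _ h; rwa [hα x] at this)
          change z.1 x + z.1 (α x) = 0
          rw [z.2 x hx, z.2 _ h, add_zero]⟩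
      map_add' := fun z w => by ext x; simp; ring
      map_smul' := fun r z => by ext x; simp; ring }
  have h1 := LinearMap.finrank_range_add_finrank_ker φ
  have h2 : finrank (ZMod 2) (LinearMap.range φ) ≤ _ := Submodule.finrank_le _
  let ι : LinearMap.ker φ →ₗ[ZMod 2] ↥(invariantUnder α ⊓ supportedIn A) :=
    { toFun := fun z => ⟨z.1.1, by
        refine ⟨fun x => ?_, z.1.2⟩
        have h : z.1.1 x + z.1.1 (α x) = 0 := congrFun (congrArg Subtype.val z.2) x
        exact (CharTwo.add_eq_zero.1 h).symm⟩
      map_add' := fun _ _ => rfl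
      map_smul' := fun _ _ => rfl }
  have hι : Function.Injective ι := fun z w h =>
    Subtype.ext (Subtype.ext (congrArg (fun y => y.1) h))
  have h3 := LinearMap.finrank_le_finrank_of_injective hι
  rw [finrank_supportedIn] at h1
  omega

end LinearAlgebra

/-! ### Tetrahedral vertices -/

theorem matching_third : ∀ (c d : Fin 3), c ≠ d → ∀ i : Fin 4,
    matching c (matching d i) = matching (third c d) i := by decide

theorem eq_or_matching : ∀ i j : Fin 4, j = i ∨ ∃ c, j = matching c i := by decide

namespace Graph

instance instFiniteV (G : Graph.{u}) : Finite G.V := G.finite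

instance instFiniteFace (G : Graph.{u}) (c : Fin 3) : Finite (G.Face c) := by
  unfold Face; infer_instance

/-- The face of colour `c` through the half-edge `x`. -/
def face (G : Graph.{u}) (c : Fin 3) (x : G.V × Fin 4) : G.Face c := Quot.mk _ x

theorem face_surjective (G : Graph.{u}) {c : Fin 3} (f : G.Face c) : ∃ x, G.face c x = f :=
  Quot.exists_rep f

/-- All the vertices are tetrahedral. -/
def Tetrahedral (G : Graph.{u}) : Prop := ∀ v, G.kind v = .tetra

/-- The number of the components that hold a vertex. -/
noncomputable def numVertexComponents (G : Graph.{u}) : ℕ :=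
  Nat.card (Quot fun v w : G.V => ∃ i j : Fin 4, G.edge (v, i) = (w, j))

variable {G : Graph.{u}}

theorem edge_involutive (G : Graph.{u}) : Function.Involutive G.edge := G.edge_edge

theorem edge_eq_comm {x y : G.V × Fin 4} : G.edge x = y ↔ G.edge y = x :=
  G.edge_involutive.eq_iff.trans eq_comm

theorem corner_involutive (G : Graph.{u}) (c : Fin 3) : Function.Involutive (G.corner c) :=
  fun _ => Prod.ext rfl (VertexKind.strand_strand _ _ _)

theorem corner_ne (G : Graph.{u}) (c : Fin 3) (x : G.V × Fin 4) : G.corner c x ≠ x :=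
  fun h => VertexKind.strand_ne _ _ _ (congrArg Prod.snd h)

@[simp] theorem corner_fst (c : Fin 3) (x : G.V × Fin 4) : (G.corner c x).1 = x.1 := rfl

@[simp] theorem face_corner (c : Fin 3) (x : G.V × Fin 4) :
    G.face c (G.corner c x) = G.face c x :=
  Eq.symm (Quot.sound (r := fun x y => G.corner c x = y ∨ G.edge x = y) (Or.inl rfl))

@[simp] theorem face_edge (c : Fin 3) (x : G.V × Fin 4) :
    G.face c (G.edge x) = G.face c x :=
  Eq.symm (Quot.sound (r := fun x y => G.corner c x = y ∨ G.edge x = y) (Or.inr rfl))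

/-- A function that is constant along the faces of colour `c`, as a function on the faces. -/
def liftFace {α : Type*} (c : Fin 3) (D : G.V × Fin 4 → α) (h1 : ∀ x, D (G.corner c x) = D x)
    (h2 : ∀ x, D (G.edge x) = D x) : G.Face c → α :=
  Quot.lift D (by rintro x _ (rfl | rfl) <;> simp [h1, h2])

theorem Tetrahedral.corner_eq (hT : G.Tetrahedral) (c : Fin 3) (x : G.V × Fin 4) :
    G.corner c x = (x.1, matching c x.2) := by
  simp [corner, hT x.1, VertexKind.strand]

theorem Tetrahedral.corner_corner (hT : G.Tetrahedral) {c d : Fin 3} (h : c ≠ d)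
    (x : G.V × Fin 4) : G.corner c (G.corner d x) = G.corner (third c d) x := by
  simp [hT.corner_eq, matching_third c d h]

theorem Tetrahedral.eq_or_corner (hT : G.Tetrahedral) {x y : G.V × Fin 4} (h : y.1 = x.1) :
    y = x ∨ ∃ c, y = G.corner c x := by
  rcases eq_or_matching x.2 y.2 with h' | ⟨c, h'⟩
  · exact Or.inl (Prod.ext h h')
  · exact Or.inr ⟨c, by rw [hT.corner_eq]; exact Prod.ext h h'⟩

theorem eq_or_eq_or_eq_third : ∀ a b : Fin 3, a ≠ b → ∀ d, d = a ∨ d = b ∨ d = third a b := by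
  decide

/-- A function on the half-edges of a vertex that two of the corners preserve is constant. -/
theorem Tetrahedral.eq_of_corner_eq (hT : G.Tetrahedral) {α : Type*} {D : G.V × Fin 4 → α} {v : G.V}
    {a b : Fin 3} (hab : a ≠ b) (ha : ∀ x, x.1 = v → D (G.corner a x) = D x)
    (hb : ∀ x, x.1 = v → D (G.corner b x) = D x) {x y : G.V × Fin 4} (hx : x.1 = v)
    (hy : y.1 = v) : D y = D x := by
  rcases hT.eq_or_corner (hy.trans hx.symm) with rfl | ⟨d, rfl⟩
  · rfl
  · rcases eq_or_eq_or_eq_third a b hab d with rfl | rfl | rfl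
    · exact ha x hx
    · exact hb x hx
    · rw [← hT.corner_corner hab, ha (G.corner b x) hx, hb x hx]

/-- Connectedness in the form of an induction principle: since `edge` is an involution, a property
that spreads along edges also spreads backwards, hence descends to the components. -/
theorem mem_of_edge_closed (hG : G.numVertexComponents = 1) {K : G.V → Prop}
    (hK : ∀ x : G.V × Fin 4, K x.1 → K (G.edge x).1) {v : G.V} (hv : K v) (w : G.V) : K w := by
  let P : (Quot fun v w : G.V => ∃ i j : Fin 4, G.edge (v, i) = (w, j)) → Prop :=
    Quot.lift K (by
      rintro v w ⟨i, j, h⟩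
      refine propext ⟨fun hv => ?_, fun hw => ?_⟩
      · have := hK (v, i) hv
        rwa [h] at this
      · have := hK (w, j) hw
        rwa [edge_eq_comm.1 h] at this)
  have := (Nat.card_eq_one_iff_unique.1 hG).1
  have h : P (Quot.mk _ v) := hv
  rw [Subsingleton.elim (Quot.mk _ v) (Quot.mk _ w)] at h
  exact h

theorem sum_eq_zero_of_matching (c : Fin 3) {g : Fin 4 → ZMod 2} (h : ∀ i, g (matching c i) = g i) :
    ∑ i, g i = 0 :=
  Finset.sum_involution (fun i _ => matching c i)
    (fun i _ => by rw [h]; exact CharTwo.add_self_eq_zero _)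
    (fun i _ _ => matching_ne c i) (fun _ _ => Finset.mem_univ _)
    (fun i _ => matching_matching c i)

theorem Tetrahedral.sum_eq_zero (hT : G.Tetrahedral) {c : Fin 3} {z : G.V × Fin 4 → ZMod 2}
    (h : ∀ x, z (G.corner c x) = z x) (v : G.V) : ∑ i, z (v, i) = 0 :=
  sum_eq_zero_of_matching c fun i => by rw [← h (v, i), hT.corner_eq]

/-! ### The homology of a jacket -/

/-- The boundary of a set of faces of the colours `a` and `b`, as a set of edges. -/
def faceBoundary (G : Graph.{u}) (a b : Fin 3) :
    (G.Face a → ZMod 2) × (G.Face b → ZMod 2) →ₗ[ZMod 2] (G.V × Fin 4 → ZMod 2) where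
  toFun D x := D.1 (G.face a x) + D.2 (G.face b x)
  map_add' D D' := by ext x; simp; ring
  map_smul' r D := by ext x; simp; ring

/-- The boundary of a set of edges. -/
def edgeBoundary (G : Graph.{u}) : (G.V × Fin 4 → ZMod 2) →ₗ[ZMod 2] (G.V → ZMod 2) where
  toFun z v := ∑ i, z (v, i)
  map_add' z w := by ext v; simp [Finset.sum_add_distrib]
  map_smul' r z := by ext v; simp [Finset.mul_sum]

/-- The cycles of edges. -/
def cycles (G : Graph.{u}) : Submodule (ZMod 2) (G.V × Fin 4 → ZMod 2) :=
  invariantUnder G.edge ⊓ LinearMap.ker G.edgeBoundary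

/-- There are 2V edges, and on a connected graph the boundary map has rank at least V - 1, which
leaves at most V + 1 for the cycles. -/
theorem finrank_cycles_le (hG : G.numVertexComponents = 1) :
    finrank (ZMod 2) G.cycles ≤ Nat.card G.V + 1 := by
  classical
  have := Fintype.ofFinite G.V
  let f : invariantUnder G.edge →ₗ[ZMod 2] (G.V → ZMod 2) :=
    G.edgeBoundary.comp (invariantUnder G.edge).subtype
  have h1 := LinearMap.finrank_range_add_finrank_ker f
  have h2 := two_mul_finrank_invariantUnder_le G.edge_involutive G.edge_ne
  have h3 : finrank (ZMod 2) G.cycles ≤ finrank (ZMod 2) (LinearMap.ker f) := by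
    let ι : G.cycles →ₗ[ZMod 2] LinearMap.ker f :=
      { toFun := fun z => ⟨⟨z.1, z.2.1⟩, z.2.2⟩
        map_add' := fun _ _ => rfl
        map_smul' := fun _ _ => rfl }
    refine LinearMap.finrank_le_finrank_of_injective (f := ι) fun z w h => Subtype.ext ?_
    exact congrArg (fun y => y.1.1) h
  have h4 : Nat.card (G.V × Fin 4) = 4 * Nat.card G.V := by simp [mul_comm]
  obtain ⟨v₀⟩ : Nonempty G.V := by
    obtain ⟨q⟩ := (Nat.card_eq_one_iff_unique.1 hG).2
    exact q.exists_rep.nonempty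
  -- The boundary of a path from `v₀` to `v`, built one edge at a time.
  have h5 : ∀ v, Pi.single v (1 : ZMod 2) + Pi.single v₀ 1 ∈ LinearMap.range f := by
    refine mem_of_edge_closed hG (v := v₀) ?_ ?_
    · intro x hx
      have hx' : Pi.single x.1 (1 : ZMod 2) + Pi.single (G.edge x).1 1 ∈ LinearMap.range f := by
        refine ⟨⟨Pi.single x 1 + Pi.single (G.edge x) 1, fun y => ?_⟩, ?_⟩
        · simp only [Pi.add_apply, Pi.single_apply, G.edge_involutive.injective.eq_iff]
          rw [add_comm]
          simp only [G.edge_involutive.eq_iff]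
        · ext v
          simp only [f, LinearMap.comp_apply, Submodule.subtype_apply, edgeBoundary,
            LinearMap.coe_mk, AddHom.coe_mk, Pi.add_apply, Finset.sum_add_distrib]
          have : ∀ y : G.V × Fin 4, ∑ i, (Pi.single y (1 : ZMod 2) : _ → ZMod 2) (v, i)
              = (Pi.single y.1 1 : G.V → ZMod 2) v := by
            intro y
            by_cases h : v = y.1
            · subst h
              rw [Pi.single_eq_same, Finset.sum_eq_single y.2] <;>
                simp +contextual [Prod.ext_iff]
            · simp [Prod.ext_iff, h]
          rw [this, this]
      have h := add_mem hx hx'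
      have e : (Pi.single x.1 (1 : ZMod 2) + Pi.single v₀ 1 : G.V → ZMod 2)
          + (Pi.single x.1 1 + Pi.single (G.edge x).1 1)
          = Pi.single (G.edge x).1 1 + Pi.single v₀ 1 := by
        have := ZModModule.add_self (Pi.single x.1 (1 : ZMod 2) : G.V → ZMod 2)
        linear_combination this
      rw [e] at h
      exact h
    · have := ZModModule.add_self (Pi.single v₀ (1 : ZMod 2) : G.V → ZMod 2)
      rw [this]
      exact zero_mem _
  have h6 : (⊤ : Submodule (ZMod 2) (G.V → ZMod 2)) ≤
      LinearMap.range f ⊔ Submodule.span (ZMod 2) {Pi.single v₀ 1} := by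
    rw [← (Pi.basisFun (ZMod 2) G.V).span_eq, Submodule.span_le]
    rintro _ ⟨v, rfl⟩
    rw [Pi.basisFun_apply]
    have e : (Pi.single v (1 : ZMod 2) : G.V → ZMod 2)
        = (Pi.single v 1 + Pi.single v₀ 1) + Pi.single v₀ 1 := by
      have := ZModModule.add_self (Pi.single v₀ (1 : ZMod 2) : G.V → ZMod 2)
      linear_combination -this
    rw [e]
    exact add_mem (Submodule.mem_sup_left (h5 v))
      (Submodule.mem_sup_right (Submodule.mem_span_singleton_self _))
  have h7 := Submodule.finrank_mono h6
  have h8 := Submodule.finrank_add_le_finrank_add_finrank (LinearMap.range f)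
    (Submodule.span (ZMod 2) {(Pi.single v₀ 1 : G.V → ZMod 2)})
  have h9 : finrank (ZMod 2) (Submodule.span (ZMod 2) {(Pi.single v₀ 1 : G.V → ZMod 2)}) ≤ 1 :=
    (finrank_span_le_card _).trans (by simp)
  rw [finrank_top, finrank_fun_zmod_two] at h7
  omega

/-- A set of faces without boundary takes the same value on the two faces along each half-edge.
Corners of the two colours connect the four half-edges of a vertex, and edges connect the vertices,
so the set is empty or consists of all faces. -/
theorem finrank_ker_faceBoundary_le (hT : G.Tetrahedral) (hG : G.numVertexComponents = 1)
    {a b : Fin 3} (hab : a ≠ b) :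
    finrank (ZMod 2) (LinearMap.ker (G.faceBoundary a b)) ≤ 1 := by
  obtain ⟨v₀⟩ : Nonempty G.V := by
    obtain ⟨q⟩ := (Nat.card_eq_one_iff_unique.1 hG).2
    exact q.exists_rep.nonempty
  have key : ∀ D ∈ LinearMap.ker (G.faceBoundary a b),
      ∀ x, D.1 (G.face a x) = D.1 (G.face a (v₀, 0)) := by
    intro D hD
    have hD' : ∀ x, D.1 (G.face a x) = D.2 (G.face b x) := fun x =>
      CharTwo.add_eq_zero.1 (congrFun hD x)
    have hc : ∀ {v} {x y : G.V × Fin 4}, x.1 = v → y.1 = v →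
        D.1 (G.face a y) = D.1 (G.face a x) :=
      hT.eq_of_corner_eq (D := fun x => D.1 (G.face a x)) hab (fun x _ => by simp)
        fun x _ => by simp [hD']
    have := mem_of_edge_closed hG
      (K := fun v => D.1 (G.face a (v, 0)) = D.1 (G.face a (v₀, 0))) ?_ (v := v₀) rfl
    · intro x
      exact (hc (v := x.1) (x := (x.1, 0)) rfl rfl).trans (this x.1)
    · intro x hx
      rw [hc (v := (G.edge x).1) (x := G.edge x) (y := ((G.edge x).1, 0)) rfl rfl, face_edge, ← hx]
      exact hc (v := x.1) rfl rfl
  have hle : LinearMap.ker (G.faceBoundary a b) ≤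
      Submodule.span (ZMod 2) {((fun _ => 1, fun _ => 1) : (G.Face a → ZMod 2) × _)} := by
    intro D hD
    refine Submodule.mem_span_singleton.2 ⟨D.1 (G.face a (v₀, 0)), ?_⟩
    refine Prod.ext (funext fun f => ?_) (funext fun f => ?_)
    · obtain ⟨x, rfl⟩ := G.face_surjective f
      simpa [Pi.smul_apply] using (key D hD x).symm
    · obtain ⟨x, rfl⟩ := G.face_surjective f
      have : D.1 (G.face a x) = D.2 (G.face b x) := CharTwo.add_eq_zero.1 (congrFun hD x)
      simpa using (key D hD x).symm.trans this
  exact (Submodule.finrank_mono hle).trans ((finrank_span_le_card _).trans (by simp))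

theorem range_faceBoundary_le (hT : G.Tetrahedral) (a b : Fin 3) :
    LinearMap.range (G.faceBoundary a b) ≤ G.cycles := by
  rintro _ ⟨D, rfl⟩
  refine ⟨fun x => by simp [faceBoundary], funext fun v => ?_⟩
  change ∑ i, (D.1 (G.face a (v, i)) + D.2 (G.face b (v, i))) = 0
  rw [Finset.sum_add_distrib,
    hT.sum_eq_zero (c := a) (z := fun x => D.1 (G.face a x)) (fun x => by simp),
    hT.sum_eq_zero (c := b) (z := fun x => D.2 (G.face b x)) (fun x => by simp), add_zero]

theorem finrank_faceBoundary_domain (a b : Fin 3) :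
    finrank (ZMod 2) ((G.Face a → ZMod 2) × (G.Face b → ZMod 2))
      = Nat.card (G.Face a) + Nat.card (G.Face b) := by
  rw [finrank_prod, finrank_fun_zmod_two, finrank_fun_zmod_two]

/-- The Euler characteristic of a connected jacket is at most two. -/
theorem card_face_add_card_face_le (hT : G.Tetrahedral) (hG : G.numVertexComponents = 1)
    {a b : Fin 3} (hab : a ≠ b) :
    Nat.card (G.Face a) + Nat.card (G.Face b) ≤ Nat.card G.V + 2 := by
  have h1 := LinearMap.finrank_range_add_finrank_ker (G.faceBoundary a b)
  have h2 := Submodule.finrank_mono (range_faceBoundary_le hT a b)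
  have h3 := finrank_cycles_le hG
  have h4 := finrank_ker_faceBoundary_le hT hG hab
  rw [finrank_faceBoundary_domain] at h1
  omega

/-- The jackets are planar: any two colours have as many faces as Euler's formula allows. -/
def PlanarJackets (G : Graph.{u}) : Prop :=
  ∀ a b : Fin 3, a ≠ b → Nat.card (G.Face a) + Nat.card (G.Face b) = Nat.card G.V + 2

/-- On a planar jacket every cycle of edges bounds. -/
theorem range_faceBoundary_eq (hT : G.Tetrahedral) (hG : G.numVertexComponents = 1)
    (hP : G.PlanarJackets) {a b : Fin 3} (hab : a ≠ b) :
    LinearMap.range (G.faceBoundary a b) = G.cycles := by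
  refine Submodule.eq_of_le_of_finrank_le (range_faceBoundary_le hT a b) ?_
  have h1 := LinearMap.finrank_range_add_finrank_ker (G.faceBoundary a b)
  have h3 := finrank_cycles_le hG
  have h4 := finrank_ker_faceBoundary_le hT hG hab
  rw [finrank_faceBoundary_domain, hP a b hab] at h1
  omega

end Graph

/-! ### Parity of the face lengths when the jackets are planar -/

theorem sum_filter_zmod_two {X : Type*} [Fintype X] (z : X → ZMod 2) (s : X → Prop)
    [DecidablePred s] : ((({x | z x = 1} ∩ {x | s x}).ncard : ℕ) : ZMod 2) = ∑ x with s x, z x := by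
  classical
  have h1 : ∀ a : ZMod 2, a = if a = 1 then 1 else 0 := by decide
  have h2 : ({x | z x = 1} ∩ {x | s x}) =
      ((Finset.univ.filter fun x => s x).filter fun x => z x = 1 : Finset X) := by
    ext x; simp [and_comm]
  rw [h2, Set.ncard_coe_finset, ← Finset.sum_boole]
  exact Finset.sum_congr rfl fun x _ => (h1 _).symm

theorem exists_ne_ne : ∀ c : Fin 3, ∃ d e : Fin 3, c ≠ d ∧ d ≠ e ∧ c ≠ e := by decide

theorem third_eq : ∀ c d e : Fin 3, c ≠ d → d ≠ e → c ≠ e → third c e = d := by decide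

theorem eq_or_eq_or_eq : ∀ c d e : Fin 3, c ≠ d → d ≠ e → c ≠ e →
    ∀ g, g = c ∨ g = d ∨ g = e := by decide

/-- The set of the half-edges `0`, `c.succ` is preserved by the matching of colour `c`, and
exchanged with its complement by the two others. -/
theorem matching_flip : ∀ c d : Fin 3, d ≠ c → ∀ i : Fin 4,
    (matching d i = 0 ∨ matching d i = c.succ) ↔ ¬ (i = 0 ∨ i = c.succ) := by decide

theorem matching_preserve : ∀ (c : Fin 3) (i : Fin 4),
    (i = 0 ∨ i = c.succ) → (matching c i = 0 ∨ matching c i = c.succ) := by decide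

namespace Graph

variable {G : Graph.{u}}

theorem exists_bounding (hT : G.Tetrahedral) (hG : G.numVertexComponents = 1)
    (hP : G.PlanarJackets) {a b : Fin 3} (hab : a ≠ b) {z : G.V × Fin 4 → ZMod 2}
    (hz : ∀ x, z (G.edge x) = z x) (hs : ∀ v, ∑ i, z (v, i) = 0) :
    ∃ (D : G.Face a → ZMod 2) (D' : G.Face b → ZMod 2),
      ∀ x, z x = D (G.face a x) + D' (G.face b x) := by
  have : z ∈ G.cycles := ⟨hz, funext hs⟩
  rw [← range_faceBoundary_eq hT hG hP hab] at this
  obtain ⟨D, rfl⟩ := this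
  exact ⟨D.1, D.2, fun _ => rfl⟩

open Classical in
/-- On the jacket without the colour `c`, a face of colour `c` is a closed curve that bounds. -/
theorem exists_bounding_face (hT : G.Tetrahedral) (hG : G.numVertexComponents = 1)
    (hP : G.PlanarJackets) {a b c : Fin 3} (hab : a ≠ b) (f : G.Face c) :
    ∃ (D : G.Face a → ZMod 2) (D' : G.Face b → ZMod 2),
      ∀ x, (if G.face c x = f then 1 else 0) = D (G.face a x) + D' (G.face b x) :=
  exists_bounding hT hG hP hab (z := fun x => if G.face c x = f then 1 else 0)
    (fun x => by simp) (hT.sum_eq_zero (c := c) (z := fun x => if G.face c x = f then 1 else 0)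
      fun x => by simp)

/-- The planar jackets are orientable, which makes the lengths of the faces even. -/
theorem four_dvd_ncard_face (hT : G.Tetrahedral) (hG : G.numVertexComponents = 1)
    (hP : G.PlanarJackets) (c : Fin 3) (f : G.Face c) : 4 ∣ {x | G.face c x = f}.ncard := by
  classical
  have := Fintype.ofFinite G.V
  obtain ⟨a, b, hca, hab, hcb⟩ := exists_ne_ne c
  obtain ⟨D, D', hD⟩ := exists_bounding_face hT hG hP hab f
  -- `ε` selects one half of every edge, so counting a face inside `ε` gives its length. The set `s`
  -- below selects two half-edges of each vertex that are joined by the corner of colour `c`.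
  obtain ⟨ε, hε⟩ := exists_flip G.edge_involutive G.edge_ne
  let s : G.V × Fin 4 → Prop := fun x => x.2 = 0 ∨ x.2 = c.succ
  let z : G.V × Fin 4 → ZMod 2 := fun x => if G.face c x = f then 1 else 0
  have hA : {x | G.face c x = f} = {x | z x = 1} := by ext x; simp [z]
  have hsum : ∀ t : G.V × Fin 4 → Prop,
      ((({x | z x = 1} ∩ {x | t x}).ncard : ℕ) : ZMod 2)
        = (({x | D (G.face a x) = 1} ∩ {x | t x}).ncard : ℕ)
          + (({x | D' (G.face b x) = 1} ∩ {x | t x}).ncard : ℕ) := by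
    intro t
    rw [sum_filter_zmod_two z, sum_filter_zmod_two (fun x => D (G.face a x)),
      sum_filter_zmod_two (fun x => D' (G.face b x)), ← Finset.sum_add_distrib]
    exact Finset.sum_congr rfl fun x _ => hD x
  -- For a union of faces of another colour, the corners exchange `s` with its complement and the
  -- edges exchange `ε` with its complement: both counts are half of the total.
  have half : ∀ (d : Fin 3), d ≠ c → ∀ E : G.Face d → ZMod 2,
      ({x | E (G.face d x) = 1} ∩ {x | s x}).ncard
        = ({x | E (G.face d x) = 1} ∩ {x | ε x}).ncard := by
    intro d hd E
    have h1 := two_mul_ncard_inter (G.corner_involutive d) (B := {x | E (G.face d x) = 1})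
      (fun x hx => by simpa using hx) (s := s) fun x _ => by
        rw [hT.corner_eq]; exact matching_flip c d hd x.2
    have h2 := two_mul_ncard_inter G.edge_involutive (B := {x | E (G.face d x) = 1})
      (fun x hx => by simpa using hx) (s := ε) fun x _ => hε x
    omega
  have h1 : ((({x | z x = 1} ∩ {x | s x}).ncard : ℕ) : ZMod 2)
      = (({x | z x = 1} ∩ {x | ε x}).ncard : ℕ) := by
    rw [hsum, hsum, half a hca.symm, half b hcb.symm]
  -- The corners of colour `c` pair off the half-edges of the face inside `s`; by `h1` this parity
  -- passes to the count inside `ε`.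
  have h2 : Even ({x | z x = 1} ∩ {x | s x}).ncard := by
    refine even_ncard_of_involution (G.corner_involutive c) (G.corner_ne c) ?_
    rw [← hA]
    rintro x ⟨hx, hs⟩
    refine ⟨by simpa using hx, ?_⟩
    rw [hT.corner_eq]
    exact matching_preserve c x.2 hs
  have h3 : Even ({x | z x = 1} ∩ {x | ε x}).ncard := by
    rw [← ZMod.natCast_eq_zero_iff_even] at h2 ⊢
    rw [← h1, h2]
  have h4 := two_mul_ncard_inter G.edge_involutive (B := {x | z x = 1})
      (fun x hx => by
        rw [← hA] at hx ⊢
        simpa using hx) (s := ε) fun x _ => hε x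
  rw [hA, ← h4]
  obtain ⟨k, hk⟩ := h3
  exact ⟨k, by omega⟩

theorem ncard_face_pos (c : Fin 3) (f : G.Face c) : 0 < {x | G.face c x = f}.ncard := by
  obtain ⟨x, rfl⟩ := G.face_surjective f
  exact (Set.ncard_pos (Set.toFinite _)).2 ⟨x, rfl⟩

/-- A face is contained in any set of half-edges that meets it and that the corners and the edges
preserve. -/
theorem mem_of_face_eq {c : Fin 3} {B : G.V × Fin 4 → Prop} (h1 : ∀ x, B x → B (G.corner c x))
    (h2 : ∀ x, B x → B (G.edge x)) {x y : G.V × Fin 4} (hx : B x)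
    (h : G.face c y = G.face c x) : B y := by
  have h3 : ∀ x, B (G.corner c x) = B x := fun x =>
    propext ⟨fun h => by simpa [G.corner_involutive c x] using h1 _ h, h1 x⟩
  have h4 : ∀ x, B (G.edge x) = B x := fun x =>
    propext ⟨fun h => by simpa [G.edge_edge x] using h2 _ h, h2 x⟩
  have h5 : G.liftFace c B h3 h4 (G.face c y) = G.liftFace c B h3 h4 (G.face c x) := by rw [h]
  exact (show B y = B x from h5) ▸ hx

/-- Such an edge would close a face with only two half-edges, while their number is a multiple of
four. -/
theorem edge_ne_corner (hT : G.Tetrahedral) (hG : G.numVertexComponents = 1)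
    (hP : G.PlanarJackets) (c : Fin 3) (x : G.V × Fin 4) : G.edge x ≠ G.corner c x := by
  intro h
  have h1 := four_dvd_ncard_face hT hG hP c (G.face c x)
  have h2 : {y | G.face c y = G.face c x} ⊆ {x, G.corner c x} := by
    intro y hy
    refine mem_of_face_eq (B := fun y => y = x ∨ y = G.corner c x) ?_ ?_ (Or.inl rfl) hy
    · rintro _ (rfl | rfl)
      · exact Or.inr rfl
      · exact Or.inl (G.corner_involutive c x)
    · rintro _ (rfl | rfl)
      · exact Or.inr h
      · rw [← h]
        exact Or.inl (G.edge_edge x)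
  have h3 := Set.ncard_le_ncard h2 (Set.toFinite _)
  have h4 : ({x, G.corner c x} : Set (G.V × Fin 4)).ncard ≤ 2 :=
    (Set.ncard_insert_le _ _).trans (by rw [Set.ncard_singleton])
  have h5 := Nat.le_of_dvd (ncard_face_pos c (G.face c x)) h1
  omega

/-- Any two half-edges of a tetrahedron are joined by a corner of some colour, so a loop would bound
a face of length one. -/
theorem edge_fst_ne (hT : G.Tetrahedral) (hG : G.numVertexComponents = 1)
    (hP : G.PlanarJackets) (x : G.V × Fin 4) : (G.edge x).1 ≠ x.1 := by
  intro h
  rcases hT.eq_or_corner h with h | ⟨c, h⟩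
  · exact G.edge_ne x h
  · exact edge_ne_corner hT hG hP c x h

/-- The half-edges of a face of length two. -/
theorem exists_of_ncard_face_eq_four (hT : G.Tetrahedral) (hG : G.numVertexComponents = 1)
    (hP : G.PlanarJackets) {c : Fin 3} {f : G.Face c} (hf : {x | G.face c x = f}.ncard = 4) :
    ∃ x, G.face c x = f ∧ G.edge (G.corner c x) = G.corner c (G.edge x) ∧
      ∀ y, G.face c y = f → y.1 = x.1 ∨ y.1 = (G.edge x).1 := by
  classical
  obtain ⟨x, rfl⟩ := G.face_surjective f
  have e1 := edge_ne_corner hT hG hP c x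
  have e2 : x ≠ G.edge (G.corner c x) := fun h => e1 (edge_eq_comm.1 h.symm)
  have e3 : G.edge x ≠ G.edge (G.corner c x) := fun h =>
    G.corner_ne c x (G.edge_involutive.injective h).symm
  let B : Finset (G.V × Fin 4) := {x, G.corner c x, G.edge x, G.edge (G.corner c x)}
  have hB : B.card = 4 := by
    rw [Finset.card_insert_of_notMem, Finset.card_insert_of_notMem, Finset.card_pair e3]
    · simp only [Finset.mem_insert, Finset.mem_singleton, not_or]
      exact ⟨e1.symm, (G.edge_ne _).symm⟩
    · simp only [Finset.mem_insert, Finset.mem_singleton, not_or]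
      exact ⟨(G.corner_ne c x).symm, (G.edge_ne x).symm, e2⟩
  have hsub : (B : Set (G.V × Fin 4)) ⊆ {y | G.face c y = G.face c x} := by
    intro y hy
    simp only [B, Finset.coe_insert, Finset.coe_singleton, Set.mem_insert_iff,
      Set.mem_singleton_iff] at hy
    rcases hy with rfl | rfl | rfl | rfl <;> simp
  -- The four half-edges of `B` are distinct and fill the face, so the corner at `G.edge x` can only
  -- lead to `G.edge (G.corner c x)`.
  have heq := Set.eq_of_subset_of_ncard_le hsub
    (by rw [hf, Set.ncard_coe_finset, hB]) (Set.toFinite _)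
  have hmem : ∀ y, G.face c y = G.face c x →
      y = x ∨ y = G.corner c x ∨ y = G.edge x ∨ y = G.edge (G.corner c x) := by
    intro y hy
    have : y ∈ (B : Set (G.V × Fin 4)) := by rw [heq]; exact hy
    simpa [B] using this
  have h1 : G.edge (G.corner c x) = G.corner c (G.edge x) := by
    rcases hmem (G.corner c (G.edge x)) (by simp) with h | h | h | h
    · exact absurd ((G.corner_involutive c).eq_iff.1 h) e1
    · exact absurd ((G.corner_involutive c).injective h) (G.edge_ne x)
    · exact absurd h (G.corner_ne c _)
    · exact h.symm
  refine ⟨x, rfl, h1, fun y hy => ?_⟩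
  rcases hmem y hy with rfl | rfl | rfl | rfl
  · exact Or.inl rfl
  · exact Or.inl rfl
  · exact Or.inr rfl
  · exact Or.inr (by rw [h1]; rfl)

/-- A set of vertices that is only joined to the rest of the graph at the half-edges `p` and `q`,
whose vertices are adjacent. -/
structure IsRegion (G : Graph.{u}) (S : Set G.V) (p q : G.V × Fin 4) : Prop where
  left_notMem : p.1 ∉ S
  right_notMem : q.1 ∉ S
  adj : ∃ x, x.1 = p.1 ∧ (G.edge x).1 = q.1
  cut : ∀ x, x.1 ∈ S → (G.edge x).1 ∉ S → G.edge x = p ∨ G.edge x = q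

/-! ### Regions attached at two half-edges -/

namespace IsRegion

variable {S : Set G.V} {p q : G.V × Fin 4}

/-- The complement of a region is connected. -/
theorem not_of_notMem (hS : G.IsRegion S p q) (hG : G.numVertexComponents = 1) {K : G.V → Prop}
    (hp : ¬ K p.1) (hq : ¬ K q.1)
    (hK : ∀ x, x.1 ∉ S → K x.1 → (G.edge x).1 ∉ S → K (G.edge x).1) {v : G.V} (hv : v ∉ S) :
    ¬ K v := by
  intro h
  refine hp (mem_of_edge_closed hG (K := fun v => v ∉ S ∧ K v) ?_ ⟨hv, h⟩ p.1).2
  rintro x ⟨hx, hKx⟩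
  have h1 : (G.edge x).1 ∉ S := by
    intro h1
    rcases hS.cut (G.edge x) h1 (by rwa [G.edge_edge]) with h2 | h2 <;> rw [G.edge_edge] at h2 <;>
      subst h2
    · exact hp hKx
    · exact hq hKx
  exact ⟨h1, hK x hx hKx h1⟩

/-- Two regions are nested if the ends of one lie in the other, and not conversely. -/
theorem ssubset (hS : G.IsRegion S p q) (hG : G.numVertexComponents = 1) {U : Set G.V}
    {p' q' : G.V × Fin 4} (hU : G.IsRegion U p' q') (hp' : p'.1 ∈ S) (hq' : q'.1 ∈ S)
    (hp : p.1 ∉ U) : U ⊂ S := by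
  -- Edges can leave `U` only at the vertices of `p'` and `q'`, which lie in `S`.
  have key : ∀ x, x.1 ∈ U → (G.edge x).1 ∉ S → (G.edge x).1 ∈ U := by
    intro x hx h
    by_contra h'
    rcases hU.cut x hx h' with h2 | h2 <;> rw [h2] at h
    · exact h hp'
    · exact h hq'
  refine (Set.ssubset_iff_of_subset fun v hv => ?_).2 ⟨p'.1, hp', hU.left_notMem⟩
  by_contra hvS
  refine hS.not_of_notMem hG (K := (· ∈ U)) hp ?_ (fun x _ hx h => key x hx h) hvS hv
  intro hq
  -- The edge between the vertices of `q` and `p` runs outside `S`, so `U` could not hold one of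
  -- them without the other.
  obtain ⟨x, hx1, hx2⟩ := hS.adj
  have := key (G.edge x) (by rwa [hx2]) (by rw [G.edge_edge, hx1]; exact hS.left_notMem)
  rw [G.edge_edge, hx1] at this
  exact hp this

end IsRegion

/-- The faces all of whose half-edges belong to the vertices of `S`. -/
def facesIn (G : Graph.{u}) (c : Fin 3) (S : Set G.V) : Set (G.Face c) :=
  {f | ∀ x, G.face c x = f → x.1 ∈ S}

theorem ncard_fst_mem (S : Set G.V) : {x : G.V × Fin 4 | x.1 ∈ S}.ncard = 4 * S.ncard := by
  have : {x : G.V × Fin 4 | x.1 ∈ S} = S ×ˢ (Set.univ : Set (Fin 4)) := by ext; simp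
  rw [this, Set.ncard_prod, Set.ncard_univ]
  simp [mul_comm]

/-- The cycles of edges inside a region bound faces inside the region. -/
theorem IsRegion.ncard_le (hT : G.Tetrahedral) (hG : G.numVertexComponents = 1)
    (hP : G.PlanarJackets) {S : Set G.V} {p q : G.V × Fin 4} (hS : G.IsRegion S p q)
    (hne : S.Nonempty) {a b : Fin 3} (hab : a ≠ b) :
    S.ncard ≤ (G.facesIn a S).ncard + (G.facesIn b S).ncard := by
  classical
  have := Fintype.ofFinite G.V
  obtain ⟨s₀, hs₀⟩ := hne
  let A : Set (G.V × Fin 4) := {x | x.1 ∈ S ∧ (G.edge x).1 ∈ S}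
  have h1 := card_le_two_mul_finrank_invariantUnder G.edge_involutive (A := A)
    fun x hx => ⟨hx.2, by rw [G.edge_edge]; exact hx.1⟩
  -- At most two half-edges leave the region, so there are at least 2|S| - 1 inner edges.
  have h2 : 4 * S.ncard ≤ A.ncard + 2 := by
    rw [← ncard_fst_mem]
    have hsub : {x : G.V × Fin 4 | x.1 ∈ S} ⊆ A ∪ {G.edge p, G.edge q} := by
      intro x hx
      by_cases h : (G.edge x).1 ∈ S
      · exact Or.inl ⟨hx, h⟩
      · exact Or.inr ((hS.cut x hx h).imp (fun h => (edge_eq_comm.1 h).symm)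
          fun h => (edge_eq_comm.1 h).symm)
    refine (Set.ncard_le_ncard hsub (Set.toFinite _)).trans ((Set.ncard_union_le _ _).trans ?_)
    have : ({G.edge p, G.edge q} : Set (G.V × Fin 4)).ncard ≤ 2 :=
      (Set.ncard_insert_le _ _).trans (by rw [Set.ncard_singleton])
    omega
  -- The condition at `s₀` follows from the others, because the boundary of any set of edges has
  -- total zero. Only |S| - 1 conditions remain, so the cycles inside the region have dimension at
  -- least |S|.
  let r : ↥(invariantUnder G.edge ⊓ supportedIn A) →ₗ[ZMod 2] (↥(S \ {s₀}) → ZMod 2) :=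
    { toFun := fun z v => G.edgeBoundary z.1 v
      map_add' := fun z w => by ext v; simp
      map_smul' := fun k z => by ext v; simp }
  have h3 := LinearMap.finrank_range_add_finrank_ker r
  have h4 : finrank (ZMod 2) (LinearMap.range r) ≤ _ := Submodule.finrank_le _
  rw [finrank_fun_zmod_two, Nat.card_coe_set_eq] at h4
  have h5 := Set.ncard_sdiff_singleton_add_one hs₀ (Set.toFinite S)
  let M : ↥(supportedIn (G.facesIn a S)) × ↥(supportedIn (G.facesIn b S)) →ₗ[ZMod 2]
      (G.V × Fin 4 → ZMod 2) :=
    (G.faceBoundary a b).comp ((supportedIn (G.facesIn a S)).subtype.prodMap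
      (supportedIn (G.facesIn b S)).subtype)
  have h6 := LinearMap.finrank_range_le M
  rw [finrank_prod, finrank_supportedIn, finrank_supportedIn, Nat.card_coe_set_eq,
    Nat.card_coe_set_eq] at h6
  have key : ∀ z : LinearMap.ker r, z.1.1 ∈ LinearMap.range M := by
    rintro ⟨⟨z, hz, hzA⟩, hzr⟩
    have hzr' : ∀ v ∈ S, v ≠ s₀ → ∑ i, z (v, i) = 0 := fun v hv hvs =>
      congrFun hzr ⟨v, hv, hvs⟩
    have hout : ∀ x : G.V × Fin 4, x.1 ∉ S → z x = 0 := fun x hx => hzA x fun h => hx h.1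
    have hne : ∀ v, v ≠ s₀ → ∑ i, z (v, i) = 0 := by
      intro v hv
      by_cases h : v ∈ S
      · exact hzr' v h hv
      · exact Finset.sum_eq_zero fun i _ => hout (v, i) h
    have htot : ∑ x, z x = 0 :=
      Finset.sum_involution (fun x _ => G.edge x)
        (fun x _ => by rw [hz]; exact CharTwo.add_self_eq_zero _)
        (fun x _ _ => G.edge_ne x) (fun _ _ => Finset.mem_univ _) (fun x _ => G.edge_edge x)
    have hcyc : ∀ v, ∑ i, z (v, i) = 0 := by
      intro v
      by_cases h : v = s₀
      · rw [Fintype.sum_prod_type, Finset.sum_eq_single s₀ (fun w _ hw => hne w hw) (by simp)]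
          at htot
        rw [h, htot]
      · exact hne v h
    obtain ⟨D, D', hD⟩ := exists_bounding hT hG hP hab hz hcyc
    have hDD : ∀ x : G.V × Fin 4, x.1 ∉ S → D (G.face a x) = D' (G.face b x) := fun x hx =>
      CharTwo.add_eq_zero.1 ((hD x).symm.trans (hout x hx))
    have hc : ∀ {v} {x y : G.V × Fin 4}, v ∉ S → x.1 = v → y.1 = v →
        D (G.face a y) = D (G.face a x) := by
      intro v x y hv
      refine hT.eq_of_corner_eq (D := fun x => D (G.face a x)) hab (fun x _ => by simp)
        fun x hx => ?_
      have hxS : x.1 ∉ S := by rwa [hx]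
      rw [hDD (G.corner b x) hxS, hDD x hxS, face_corner]
    -- No edge of the cycle lies outside `S`, so the bounding faces do not change there, and the
    -- complement of a region is connected.
    have hconst : ∀ x : G.V × Fin 4, x.1 ∉ S → D (G.face a x) = D (G.face a p) := by
      intro x hx
      have := hS.not_of_notMem hG (K := fun v => D (G.face a (v, 0)) ≠ D (G.face a p)) ?_ ?_ ?_ hx
      · exact (hc hx (x := (x.1, 0)) rfl rfl).trans (not_not.1 this)
      · exact not_not.2 (hc hS.left_notMem rfl rfl)
      · obtain ⟨y, hy1, hy2⟩ := hS.adj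
        refine not_not.2 ((hc hS.right_notMem hy2 (y := (q.1, 0)) rfl).trans ?_)
        rw [face_edge]
        exact hc hS.left_notMem rfl hy1
      · intro y hy hK hy' h
        refine hK ((hc hy (x := y) (y := (y.1, 0)) rfl rfl).trans (Eq.trans ?_ h))
        rw [← face_edge]
        exact hc hy' rfl rfl
    -- Adding the set of all faces, if necessary, makes the bounding set empty outside the region
    -- without changing its boundary.
    let k := D (G.face a p)
    refine ⟨(⟨fun f => D f + k, ?_⟩, ⟨fun f => D' f + k, ?_⟩), ?_⟩
    · intro f hf
      simp only [facesIn, Set.mem_ofPred_eq, not_forall] at hf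
      obtain ⟨x, rfl, hx⟩ := hf
      change D _ + k = 0
      rw [hconst x hx]
      exact CharTwo.add_self_eq_zero _
    · intro f hf
      simp only [facesIn, Set.mem_ofPred_eq, not_forall] at hf
      obtain ⟨x, rfl, hx⟩ := hf
      change D' _ + k = 0
      rw [← hDD x hx, hconst x hx]
      exact CharTwo.add_self_eq_zero _
    · ext x
      change (D (G.face a x) + k) + (D' (G.face b x) + k) = z x
      rw [hD x]
      linear_combination CharTwo.add_self_eq_zero k
  let ι : LinearMap.ker r →ₗ[ZMod 2] LinearMap.range M :=
    { toFun := fun z => ⟨z.1.1, key z⟩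
      map_add' := fun _ _ => rfl
      map_smul' := fun _ _ => rfl }
  have h7 := LinearMap.finrank_le_finrank_of_injective (f := ι) fun z w h =>
    Subtype.ext (Subtype.ext (congrArg (fun y => y.1) h))
  rw [Nat.card_coe_set_eq] at h1
  omega

/-! ### Short faces and the search for a melon -/

theorem mul_ncard_le (c : Fin 3) (Q : Set (G.Face c)) (n : ℕ)
    (h : ∀ f ∈ Q, n ≤ {x | G.face c x = f}.ncard) :
    n * Q.ncard ≤ {x | G.face c x ∈ Q}.ncard := by
  classical
  have := Fintype.ofFinite G.V
  have := Fintype.ofFinite (G.Face c)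
  rw [Set.ncard_eq_toFinset_card' Q, Set.ncard_eq_toFinset_card' {x | G.face c x ∈ Q}]
  rw [Finset.card_eq_sum_card_fiberwise (f := G.face c) (t := Q.toFinset)
    (fun x hx => by simpa using hx), mul_comm, ← smul_eq_mul]
  refine Finset.card_nsmul_le_sum _ _ _ fun f hf => (h f (by simpa using hf)).trans ?_
  rw [Set.ncard_eq_toFinset_card']
  refine Finset.card_le_card fun x hx => ?_
  have hx : G.face c x = f := by simpa using hx
  subst hx
  simpa using hf

/-- Otherwise each inner face has length at least four, that is, at least 8 half-edges, and two
colours share fewer than 2·4|S| of them: too few for the |S| inner faces given by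
`IsRegion.ncard_le`. -/
theorem IsRegion.exists_short_face (hT : G.Tetrahedral) (hG : G.numVertexComponents = 1)
    (hP : G.PlanarJackets) {S : Set G.V} {p q : G.V × Fin 4} (hS : G.IsRegion S p q)
    (hne : S.Nonempty) :
    ∃ (c : Fin 3) (f : G.Face c), f ∈ G.facesIn c S ∧ {x | G.face c x = f}.ncard = 4 := by
  by_contra! hcon
  have h8 : ∀ c, ∀ f ∈ G.facesIn c S, 8 ≤ {x | G.face c x = f}.ncard := by
    intro c f hf
    have h1 := four_dvd_ncard_face hT hG hP c f
    have h2 := ncard_face_pos c f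
    have h3 := hcon c f hf
    omega
  obtain ⟨y, hy, hy'⟩ : ∃ y : G.V × Fin 4, y.1 ∈ S ∧ (G.edge y).1 ∉ S := by
    by_contra! h
    obtain ⟨s, hs⟩ := hne
    exact hS.left_notMem (mem_of_edge_closed hG (K := (· ∈ S)) h hs p.1)
  -- Strict, because the half-edge `y` through which the region is left lies on no inner face.
  have h4 : ∀ c, 8 * (G.facesIn c S).ncard < 4 * S.ncard := by
    intro c
    refine (mul_ncard_le c _ 8 (h8 c)).trans_lt ?_
    rw [← ncard_fst_mem]
    refine Set.ncard_lt_ncard ((Set.ssubset_iff_of_subset fun x hx =>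
      (show ∀ y, G.face c y = G.face c x → y.1 ∈ S from hx) x rfl).2
      ⟨y, hy, fun h => hy' (h (G.edge y) (by simp))⟩) (Set.toFinite _)
  have h5 := hS.ncard_le hT hG hP hne (a := 0) (b := 1) (by decide)
  have h6 := h4 0
  have h7 := h4 1
  omega

theorem exists_short_face (hT : G.Tetrahedral) (hG : G.numVertexComponents = 1)
    (hP : G.PlanarJackets) :
    ∃ (c : Fin 3) (f : G.Face c), {x | G.face c x = f}.ncard = 4 := by
  by_contra! hcon
  have h4 : ∀ c, 8 * Nat.card (G.Face c) ≤ 4 * Nat.card G.V := by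
    intro c
    have h := mul_ncard_le c Set.univ 8 fun f _ => by
      have h1 := four_dvd_ncard_face hT hG hP c f
      have h2 := ncard_face_pos c f
      have h3 := hcon c f
      omega
    rw [Set.ncard_univ] at h
    refine h.trans ?_
    rw [← Set.ncard_univ G.V, ← ncard_fst_mem]
    exact Set.ncard_le_ncard (fun _ _ => trivial) (Set.toFinite _)
  have h5 := hP 0 1 (by decide)
  have h6 := h4 0
  have h7 := h4 1
  omega

/-- Two tetrahedral vertices that are joined by three parallel edges, any two of which bound a face
of length two; `x` and `y` are the external half-edges. -/
def IsMelon (G : Graph.{u}) (x y : G.V × Fin 4) : Prop :=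
  x.1 ≠ y.1 ∧ ∀ c, G.edge (G.corner c x) = G.corner c y

/-- A face of length two cuts the jacket without its colour into two discs: the region on the side
of the colour `d`. -/
theorem isRegion_of_bounding (hT : G.Tetrahedral) {c d e : Fin 3} (hcd : c ≠ d) (hde : d ≠ e)
    (hce : c ≠ e) (hloop : ∀ x, (G.edge x).1 ≠ x.1) {x : G.V × Fin 4}
    (hx : G.edge (G.corner c x) = G.corner c (G.edge x))
    {D : G.Face d → ZMod 2} {D' : G.Face e → ZMod 2}
    (hD : ∀ y, G.face c y = G.face c x → D' (G.face e y) = D (G.face d y) + 1)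
    (hD' : ∀ y, y.1 ≠ x.1 → y.1 ≠ (G.edge x).1 → D (G.face d y) = D' (G.face e y))
    (hDe : D (G.face d (G.corner e x)) = D' (G.face e (G.corner e x)))
    (hDe' : D (G.face d (G.corner e (G.edge x))) = D' (G.face e (G.corner e (G.edge x)))) :
    ∃ U : Set G.V, (∀ u, u ∈ U ↔ u ≠ x.1 ∧ u ≠ (G.edge x).1 ∧
        D (G.face d (u, 0)) = D (G.face d x)) ∧
      G.IsRegion U (G.corner d x) (G.corner d (G.edge x)) ∧
      (¬ U.Nonempty → ∃ y y', G.IsMelon y y') := by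
  have hc : ∀ y : G.V × Fin 4, y.1 ≠ x.1 → y.1 ≠ (G.edge x).1 →
      D (G.face d y) = D (G.face d (y.1, 0)) := by
    intro y h1 h2
    refine hT.eq_of_corner_eq (D := fun y => D (G.face d y)) hde (fun y _ => by simp)
      (v := y.1) (fun z hz => ?_) rfl rfl
    rw [hD' (G.corner e z) (by rwa [corner_fst, hz]) (by rwa [corner_fst, hz]),
      hD' z (by rwa [hz]) (by rwa [hz]), face_corner]
  -- The two potentials differ exactly along the curve, so its `d`-side carries the value of `D` at
  -- `x` and its `e`-side the other value.
  have hflip : D' (G.face e x) = D (G.face d x) + 1 := hD x rfl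
  have hne : ∀ k : ZMod 2, k + 1 ≠ k := by decide
  -- At each of the two vertices of the face, only the `e`-corner of the half-edge on the curve lies
  -- on the other side. The half-edges on the curve are joined to one another, so the `d`-corners
  -- are the only way into the region.
  have hside : ∀ y : G.V × Fin 4, D (G.face d y) = D (G.face d x) →
      (y.1 = x.1 → y = x ∨ y = G.corner c x ∨ y = G.corner d x) ∧
      (y.1 = (G.edge x).1 → y = G.edge x ∨ y = G.corner c (G.edge x) ∨
        y = G.corner d (G.edge x)) := by
    intro y hy
    constructor
    · intro h
      rcases hT.eq_or_corner h with rfl | ⟨g, rfl⟩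
      · exact Or.inl rfl
      · rcases eq_or_eq_or_eq c d e hcd hde hce g with rfl | rfl | rfl
        · exact Or.inr (Or.inl rfl)
        · exact Or.inr (Or.inr rfl)
        · rw [hDe, face_corner, hflip] at hy
          exact absurd hy (hne _)
    · intro h
      rcases hT.eq_or_corner h with rfl | ⟨g, rfl⟩
      · exact Or.inl rfl
      · rcases eq_or_eq_or_eq c d e hcd hde hce g with rfl | rfl | rfl
        · exact Or.inr (Or.inl rfl)
        · exact Or.inr (Or.inr rfl)
        · rw [hDe', face_corner, face_edge, hflip] at hy
          exact absurd hy (hne _)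
  refine ⟨{u | u ≠ x.1 ∧ u ≠ (G.edge x).1 ∧ D (G.face d (u, 0)) = D (G.face d x)},
    fun u => Iff.rfl, ⟨fun h => h.1 rfl, fun h => h.2.1 rfl, ⟨x, rfl, rfl⟩, ?_⟩, ?_⟩
  · rintro y ⟨hy1, hy2, hy3⟩ hy4
    have h1 : D (G.face d (G.edge y)) = D (G.face d x) := by
      rw [face_edge, hc y hy1 hy2, hy3]
    have h2 : (G.edge y).1 = x.1 ∨ (G.edge y).1 = (G.edge x).1 := by
      by_contra! h
      exact hy4 ⟨h.1, h.2, by rw [← hc _ h.1 h.2, h1]⟩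
    rcases h2 with h2 | h2
    · rcases (hside _ h1).1 h2 with h | h | h
      · exact absurd (congrArg Prod.fst (edge_eq_comm.1 h).symm) hy2
      · rw [edge_eq_comm, hx] at h
        exact absurd (congrArg Prod.fst h.symm) hy2
      · exact Or.inl h
    · rcases (hside _ h1).2 h2 with h | h | h
      · exact absurd (congrArg Prod.fst (G.edge_involutive.injective h)) hy1
      · rw [← hx] at h
        exact absurd (congrArg Prod.fst (G.edge_involutive.injective h)) hy1
      · exact Or.inr h
  · intro hU
    -- The edge at the `d`-corner of `x` stays on this side. With no vertex there and no loops it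
    -- must end at the `d`-corner of `G.edge x`, and is the third parallel edge.
    have h1 : D (G.face d (G.edge (G.corner d x))) = D (G.face d x) := by simp
    have h2 : (G.edge (G.corner d x)).1 = (G.edge x).1 := by
      by_contra h
      exact hU ⟨(G.edge (G.corner d x)).1, hloop _, h, by
        rw [← hc (G.edge (G.corner d x)) (hloop (G.corner d x)) h, h1]⟩
    have h3 : G.edge (G.corner d x) = G.corner d (G.edge x) := by
      rcases (hside _ h1).2 h2 with h | h | h
      · exact absurd (G.edge_involutive.injective h) (G.corner_ne d x)
      · rw [← hx] at h
        have := G.edge_involutive.injective h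
        rw [hT.corner_eq, hT.corner_eq] at this
        have h4 : ∀ c d : Fin 3, c ≠ d → ∀ i : Fin 4, matching d i ≠ matching c i := by decide
        exact absurd (congrArg Prod.snd this) (h4 c d hcd x.2)
      · exact h
    refine ⟨G.corner e x, G.corner e (G.edge x), (hloop x).symm, fun g => ?_⟩
    rcases eq_or_eq_or_eq c d e hcd hde hce g with rfl | rfl | rfl
    · rw [hT.corner_corner hce, hT.corner_corner hce, third_eq g d e hcd hde hce, h3]
    · rw [hT.corner_corner hde, hT.corner_corner hde, third_eq g c e hcd.symm hce hde, hx]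
    · rw [G.corner_involutive g, G.corner_involutive g]

/-- The construction of one side is applied twice, with the roles of the two other colours
exchanged. The sides are disjoint because the two potentials agree off the curve, and the values
that define the sides differ by one. -/
theorem exists_regions (hT : G.Tetrahedral) (hG : G.numVertexComponents = 1)
    (hP : G.PlanarJackets) {c : Fin 3} {f : G.Face c} (hf : {x | G.face c x = f}.ncard = 4) :
    ∃ (x : G.V × Fin 4) (d e : Fin 3) (U U' : Set G.V), G.face c x = f ∧ Disjoint U U' ∧
      G.IsRegion U (G.corner d x) (G.corner d (G.edge x)) ∧
      G.IsRegion U' (G.corner e x) (G.corner e (G.edge x)) ∧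
      (¬ U.Nonempty → ∃ y y', G.IsMelon y y') ∧ (¬ U'.Nonempty → ∃ y y', G.IsMelon y y') := by
  classical
  obtain ⟨d, e, hcd, hde, hce⟩ := exists_ne_ne c
  obtain ⟨x, rfl, hx, hxf⟩ := exists_of_ncard_face_eq_four hT hG hP hf
  obtain ⟨D, D', hD⟩ := exists_bounding_face hT hG hP hde (G.face c x)
  have hloop := edge_fst_ne hT hG hP
  have h1 : ∀ y, G.face c y = G.face c x → D' (G.face e y) = D (G.face d y) + 1 := by
    intro y hy
    have := hD y
    rw [if_pos hy] at this
    rw [this]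
    linear_combination -CharTwo.add_self_eq_zero (D (G.face d y))
  have h2 : ∀ y, G.face c y ≠ G.face c x → D (G.face d y) = D' (G.face e y) := by
    intro y hy
    have := hD y
    rw [if_neg hy] at this
    exact CharTwo.add_eq_zero.1 this.symm
  have h3 : ∀ y, y.1 ≠ x.1 → y.1 ≠ (G.edge x).1 → D (G.face d y) = D' (G.face e y) := by
    intro y hy hy'
    refine h2 y fun h => ?_
    rcases hxf y h with h | h
    · exact hy h
    · exact hy' h
  have hB : ∀ y, G.face c y = G.face c x →
      y = x ∨ y = G.corner c x ∨ y = G.edge x ∨ y = G.corner c (G.edge x) := by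
    intro y hy
    refine mem_of_face_eq (B := fun y => y = x ∨ y = G.corner c x ∨ y = G.edge x ∨
      y = G.corner c (G.edge x)) ?_ ?_ (Or.inl rfl) hy
    · rintro _ (rfl | rfl | rfl | rfl) <;> simp [G.corner_involutive c _]
    · rintro _ (rfl | rfl | rfl | rfl)
      · simp
      · simp [hx]
      · simp [G.edge_edge]
      · simp [← hx, G.edge_edge]
  have hcc : ∀ c d : Fin 3, c ≠ d → ∀ i : Fin 4, matching d i ≠ matching c i := by decide
  have hcorner : ∀ g, c ≠ g → G.face c (G.corner g x) ≠ G.face c x := by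
    intro g hg h
    rcases hB _ h with h | h | h | h
    · exact G.corner_ne g x h
    · rw [hT.corner_eq, hT.corner_eq] at h
      exact hcc c g hg x.2 (congrArg Prod.snd h)
    · exact hloop x (congrArg Prod.fst h).symm
    · exact hloop x (congrArg Prod.fst h).symm
  have hcorner' : ∀ g, c ≠ g → G.face c (G.corner g (G.edge x)) ≠ G.face c x := by
    intro g hg h
    rcases hB _ h with h | h | h | h
    · exact hloop x (congrArg Prod.fst h :)
    · exact hloop x (congrArg Prod.fst h :)
    · exact G.corner_ne g _ h
    · rw [hT.corner_eq, hT.corner_eq] at h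
      exact hcc c g hg _ (congrArg Prod.snd h)
  obtain ⟨U, hU, hU1, hU2⟩ := isRegion_of_bounding hT hcd hde hce hloop hx h1 h3
    (h2 _ (hcorner e hce)) (h2 _ (hcorner' e hce))
  obtain ⟨U', hU', hU1', hU2'⟩ := isRegion_of_bounding hT hce hde.symm hcd hloop hx
    (D := D') (D' := D)
    (fun y hy => by rw [h1 y hy]; linear_combination -CharTwo.add_self_eq_zero (1 : ZMod 2))
    (fun y hy hy' => (h3 y hy hy').symm)
    (h2 _ (hcorner d hcd)).symm (h2 _ (hcorner' d hcd)).symm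
  refine ⟨x, d, e, U, U', rfl, Set.disjoint_left.2 fun u hu hu' => ?_, hU1, hU1', hU2, hU2'⟩
  rw [hU] at hu
  rw [hU', ← h3 _ hu.1 hu.2.1, hu.2.2, h1 x rfl] at hu'
  have hne : ∀ k : ZMod 2, k ≠ k + 1 := by decide
  exact hne _ hu'.2.2

/-- Descent on the size of the region: a short face inside it has two disjoint sides, and a side
that avoids the vertex of `p` is strictly nested in the region. -/
theorem IsRegion.exists_isMelon (hT : G.Tetrahedral) (hG : G.numVertexComponents = 1)
    (hP : G.PlanarJackets) : ∀ (n : ℕ) {S : Set G.V} {p q : G.V × Fin 4}, S.ncard = n →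
      G.IsRegion S p q → S.Nonempty → ∃ y y', G.IsMelon y y' := by
  intro n
  induction n using Nat.strong_induction_on with
  | _ n ih =>
    intro S p q hn hS hne
    obtain ⟨c, f, hfS, hf⟩ := hS.exists_short_face hT hG hP hne
    obtain ⟨x, d, e, U, U', hx, hdis, hU, hU', hm, hm'⟩ := exists_regions hT hG hP hf
    have hx1 : x.1 ∈ S := hfS x hx
    have hx2 : (G.edge x).1 ∈ S := hfS _ (by simpa using hx)
    by_cases h1 : U.Nonempty
    · by_cases h2 : U'.Nonempty
      · by_cases hp : p.1 ∈ U
        · have hsub := hS.ssubset hG hU' hx1 hx2 (Set.disjoint_left.1 hdis hp)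
          exact ih _ (hn ▸ Set.ncard_lt_ncard hsub (Set.toFinite _)) rfl hU' h2
        · have hsub := hS.ssubset hG hU hx1 hx2 hp
          exact ih _ (hn ▸ Set.ncard_lt_ncard hsub (Set.toFinite _)) rfl hU h1
      · exact hm' h2
    · exact hm h1

/-- A connected graph with planar jackets contains a melon. -/
theorem exists_isMelon (hT : G.Tetrahedral) (hG : G.numVertexComponents = 1)
    (hP : G.PlanarJackets) : ∃ y y', G.IsMelon y y' := by
  obtain ⟨c, f, hf⟩ := exists_short_face hT hG hP
  obtain ⟨x, d, e, U, U', -, -, hU, -, hm, -⟩ := exists_regions hT hG hP hf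
  by_cases h : U.Nonempty
  · exact hU.exists_isMelon hT hG hP _ rfl h
  · exact hm h

theorem quot_mk_eq {α : Sort*} {r : α → α → Prop} {x y : α} (h : r x y) :
    Quot.mk r y = Quot.mk r x :=
  (Quot.sound h).symm

/-! ### Components -/

/-- The component of a vertex. -/
def component (G : Graph.{u}) (v : G.V) :
    Quot fun v w : G.V => ∃ i j : Fin 4, G.edge (v, i) = (w, j) := Quot.mk _ v

theorem component_edge (x : G.V × Fin 4) : G.component (G.edge x).1 = G.component x.1 :=
  Eq.symm (Quot.sound (r := fun v w : G.V => ∃ i j : Fin 4, G.edge (v, i) = (w, j))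
    ⟨x.2, (G.edge x).2, rfl⟩)

/-- A function on the vertices that is constant along the edges, as a function on the components. -/
def liftComponent {α : Type*} (K : G.V → α) (h : ∀ x : G.V × Fin 4, K (G.edge x).1 = K x.1) :
    (Quot fun v w : G.V => ∃ i j : Fin 4, G.edge (v, i) = (w, j)) → α :=
  Quot.lift K (by
    rintro v w ⟨i, j, hvw⟩
    have := h (v, i)
    rw [hvw] at this
    exact this.symm)

/-! ### The numbers of a jacket -/

/-- `side` exchanges the two remaining colours, so the corners of both act on each half-edge, and
these two connect the four half-edges of the vertex. Hence a jacket has the same vertices as the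
graph. -/
theorem Tetrahedral.jacket_eq (hT : G.Tetrahedral) (i : Fin 3) {α : Type*}
    {D : (G.jacket i).Flag → α} (h1 : ∀ x, D ((G.jacket i).side x) = D x)
    (h2 : ∀ x, D ((G.jacket i).corner x) = D x) {x y : (G.jacket i).Flag} (h : x.1.1 = y.1.1) :
    D x = D y := by
  have hside : ∀ (z : G.V × Fin 4) (a b : {c : Fin 3 // c ≠ i}), D (z, a) = D (z, b) := by
    rintro z ⟨a, ha⟩ ⟨b, hb⟩
    have hab : ∀ i a b : Fin 3, a ≠ i → b ≠ i → a = b ∨ third i b = a := by decide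
    rcases hab i a b ha hb with rfl | rfl
    · rfl
    · exact h1 (z, ⟨b, hb⟩)
  have hi : ∀ i : Fin 3, ∃ a b, a ≠ i ∧ b ≠ i ∧ a ≠ b := by decide
  obtain ⟨a, b, ha, hb, hab⟩ := hi i
  have key := hT.eq_of_corner_eq (D := fun z => D (z, ⟨a, ha⟩)) (v := y.1.1) hab
    (fun z _ => h2 (z, ⟨a, ha⟩))
    (fun z _ => (hside _ _ ⟨b, hb⟩).trans ((h2 (z, ⟨b, hb⟩)).trans (hside _ _ _))) rfl h
  exact (hside x.1 x.2 ⟨a, ha⟩).trans (key.trans (hside y.1 _ _))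

theorem exists_flag_color (i : Fin 3) : Nonempty {c : Fin 3 // c ≠ i} := by
  have h : ∀ i : Fin 3, ∃ c, c ≠ i := by decide
  obtain ⟨c, hc⟩ := h i
  exact ⟨⟨c, hc⟩⟩

theorem Tetrahedral.numVertices_jacket (hT : G.Tetrahedral) (i : Fin 3) :
    (G.jacket i).numVertices = Nat.card G.V := by
  obtain ⟨a⟩ := exists_flag_color i
  refine Nat.card_congr (Equiv.ofBijective
    (Quot.lift (fun x => x.1.1) (by rintro x _ (rfl | rfl) <;> rfl)) ⟨?_, fun v => ?_⟩)
  · rintro ⟨x⟩ ⟨y⟩ h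
    refine hT.jacket_eq i (D := Quot.mk _) (fun z => ?_) (fun z => ?_) h
    · exact quot_mk_eq (Or.inl rfl)
    · exact quot_mk_eq (Or.inr rfl)
  · exact ⟨Quot.mk _ ((v, 0), a), rfl⟩

theorem Tetrahedral.numComponents_jacket (hT : G.Tetrahedral) (i : Fin 3) :
    (G.jacket i).numComponents = G.numVertexComponents + G.rings := by
  obtain ⟨a⟩ := exists_flag_color i
  refine congrArg (· + G.rings) (Nat.card_congr ?_)
  let r := fun x y : (G.jacket i).Flag =>
    (G.jacket i).side x = y ∨ (G.jacket i).corner x = y ∨ (G.jacket i).edge x = y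
  have key : ∀ x y : (G.jacket i).Flag, x.1.1 = y.1.1 → Quot.mk r x = Quot.mk r y :=
    fun x y h => hT.jacket_eq i (D := Quot.mk r)
      (fun z => quot_mk_eq (Or.inl rfl))
      (fun z => quot_mk_eq (Or.inr (Or.inl rfl))) h
  exact
    { toFun := Quot.lift (fun x => G.component x.1.1) (by
        rintro x _ (rfl | rfl | rfl)
        · rfl
        · rfl
        · exact (component_edge x.1).symm)
      invFun := liftComponent (fun v => Quot.mk r ((v, 0), a)) fun x =>
        (key ((((G.edge x).1, 0), a)) (G.edge x, a) rfl).trans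
          ((Quot.sound (Or.inr (Or.inr rfl)) : Quot.mk r (x, a) = Quot.mk r (G.edge x, a)).symm.trans
            (key _ _ rfl))
      left_inv := by
        rintro ⟨x⟩
        exact key _ _ rfl
      right_inv := by
        rintro ⟨v⟩
        rfl }

theorem numEdges_jacket (G : Graph.{u}) (i : Fin 3) :
    (G.jacket i).numEdges = 2 * Nat.card G.V := by
  classical
  obtain ⟨a⟩ := exists_flag_color i
  obtain ⟨s, hs⟩ := exists_flip G.edge_involutive G.edge_ne
  have h1 := two_mul_ncard_inter G.edge_involutive (B := Set.univ) (fun _ _ => trivial)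
    fun x _ => hs x
  rw [Set.univ_inter, Set.ncard_univ, Nat.card_prod, Nat.card_eq_fintype_card (α := Fin 4),
    Fintype.card_fin] at h1
  have h2 : (G.jacket i).numEdges = Nat.card {x // s x} := by
    let r := fun x y : (G.jacket i).Flag => (G.jacket i).side x = y ∨ (G.jacket i).edge x = y
    have hside : ∀ (z : G.V × Fin 4) (a b : {c : Fin 3 // c ≠ i}),
        Quot.mk r (z, a) = Quot.mk r (z, b) := by
      rintro z ⟨a, ha⟩ ⟨b, hb⟩
      have hab : ∀ i a b : Fin 3, a ≠ i → b ≠ i → a = b ∨ third i a = b := by decide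
      rcases hab i a b ha hb with rfl | rfl
      · rfl
      · exact Quot.sound (Or.inl rfl)
    refine Nat.card_congr
      { toFun := Quot.lift
          (fun x => if h : s x.1 then ⟨x.1, h⟩ else ⟨G.edge x.1, (hs _).2 h⟩) (by
            rintro x _ (rfl | rfl)
            · rfl
            · change _ = if h : s (G.edge x.1) then (⟨G.edge x.1, h⟩ : {x // s x})
                else ⟨G.edge (G.edge x.1), (hs _).2 h⟩
              by_cases h : s x.1
              · have h' : ¬ s (G.edge x.1) := fun h' => (hs _).1 h' h
                rw [dif_pos h, dif_neg h']
                exact Subtype.ext (G.edge_edge _).symm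
              · rw [dif_neg h, dif_pos ((hs _).2 h)])
        invFun := fun x => Quot.mk r (x.1, a)
        left_inv := by
          rintro ⟨x⟩
          change Quot.mk r ((if h : s x.1 then (⟨x.1, h⟩ : {x // s x})
            else ⟨G.edge x.1, (hs _).2 h⟩).1, a) = Quot.mk r x
          by_cases h : s x.1
          · rw [dif_pos h]
            exact hside _ _ _
          · rw [dif_neg h]
            exact (hside _ _ x.2).trans (quot_mk_eq (Or.inr rfl))
        right_inv := by
          rintro ⟨x, hx⟩
          exact dif_pos hx }
  rw [h2]
  have : Nat.card {x // s x} = {x | s x}.ncard := rfl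
  omega

theorem numFaces_jacket (G : Graph.{u}) (i : Fin 3) :
    (G.jacket i).numFaces
      = ∑ c : {c : Fin 3 // c ≠ i}, Nat.card (G.Face c.1) + 2 * G.rings := by
  refine congrArg (· + 2 * G.rings) ?_
  rw [← Nat.card_sigma]
  refine Nat.card_congr
    { toFun := Quot.lift (fun x => ⟨x.2, G.face x.2.1 x.1⟩) (by
        rintro x _ (rfl | rfl)
        · exact congrArg (Sigma.mk x.2) (face_corner x.2.1 x.1).symm
        · exact congrArg (Sigma.mk x.2) (face_edge x.2.1 x.1).symm)
      invFun := fun f => G.liftFace f.1.1 (fun x => Quot.mk _ (x, f.1))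
        (fun x => quot_mk_eq (Or.inl rfl)) (fun x => quot_mk_eq (Or.inr rfl)) f.2
      left_inv := by
        rintro ⟨x⟩
        rfl
      right_inv := by
        rintro ⟨c, ⟨x⟩⟩
        rfl }

/-- A ring adds one component and two faces, so it drops out of 2C - (V - E + F). -/
theorem Tetrahedral.genus_jacket (hT : G.Tetrahedral) (i : Fin 3) :
    (G.jacket i).genus = 2 * G.numVertexComponents + Nat.card G.V
      - ∑ c : {c : Fin 3 // c ≠ i}, (Nat.card (G.Face c.1) : ℤ) := by
  rw [RibbonGraph.genus, RibbonGraph.eulerChar, hT.numVertices_jacket, hT.numComponents_jacket,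
    numEdges_jacket, numFaces_jacket]
  push_cast
  ring

/-- Twice the degree, for a graph with only tetrahedral vertices. -/
noncomputable def defect (G : Graph.{u}) : ℤ :=
  6 * G.numVertexComponents + 3 * Nat.card G.V - 2 * ∑ c, (Nat.card (G.Face c) : ℤ)

theorem sum_ne_color (F : Fin 3 → ℤ) (i : Fin 3) :
    ∑ c : {c : Fin 3 // c ≠ i}, F c.1 = ∑ c, F c - F i := by
  rw [← Fintype.sum_subtype_add_sum_subtype (· ≠ i) F]
  have : ∑ c : {c : Fin 3 // ¬ c ≠ i}, F c.1 = F i := by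
    have : Unique {c : Fin 3 // ¬ c ≠ i} := ⟨⟨⟨i, by simp⟩⟩, fun c => Subtype.ext (not_not.1 c.2)⟩
    rw [Fintype.sum_unique]
    exact congrArg F (not_not.1 (default : {c : Fin 3 // ¬ c ≠ i}).2)
  rw [this]
  ring

theorem Tetrahedral.sum_genus_jacket (hT : G.Tetrahedral) :
    ∑ i, (G.jacket i).genus = G.defect := by
  simp only [hT.genus_jacket, sum_ne_color (fun c => (Nat.card (G.Face c) : ℤ)), defect,
    Fin.sum_univ_three]
  ring

theorem tetrahedral_refine (G : Graph.{u}) (r : G.V → ColorPair) : (G.refine r).Tetrahedral :=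
  fun _ => rfl

theorem degree_eq_zero_iff (G : Graph.{u}) (r : G.V → ColorPair) :
    G.degree r = 0 ↔ (G.refine r).defect = 0 := by
  rw [degree, ← (G.tetrahedral_refine r).sum_genus_jacket, ← Int.cast_sum, mul_eq_zero,
    Int.cast_eq_zero]
  norm_num

/-- Defect zero is equality in the sum of the three bounds F_a + F_b ≤ V + 2, hence equality in
each. -/
theorem Tetrahedral.planarJackets (hT : G.Tetrahedral) (hG : G.numVertexComponents = 1)
    (hd : G.defect = 0) : G.PlanarJackets := by
  have h01 := card_face_add_card_face_le hT hG (a := 0) (b := 1) (by decide)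
  have h02 := card_face_add_card_face_le hT hG (a := 0) (b := 2) (by decide)
  have h12 := card_face_add_card_face_le hT hG (a := 1) (b := 2) (by decide)
  rw [defect, hG, Fin.sum_univ_three] at hd
  intro a b hab
  have key : ∀ a b : Fin 3, a ≠ b → (a = 0 ∧ b = 1) ∨ (a = 1 ∧ b = 0) ∨ (a = 0 ∧ b = 2) ∨
      (a = 2 ∧ b = 0) ∨ (a = 1 ∧ b = 2) ∨ (a = 2 ∧ b = 1) := by decide
  rcases key a b hab with ⟨rfl, rfl⟩ | ⟨rfl, rfl⟩ | ⟨rfl, rfl⟩ | ⟨rfl, rfl⟩ | ⟨rfl, rfl⟩ | ⟨rfl, rfl⟩ <;>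
    omega

/-! ### Components of the refinement -/

/-- The resolution of a vertex is connected by its internal edges. This matches the convention that
a double trace is a single vertex, and makes refinement preserve the components. -/
theorem _root_.CTKT.VertexKind.eq_of_slot_eq (κ : VertexKind) (p : ColorPair) {α : Type*}
    {D : Fin κ.size → α} (hD : ∀ l m, κ.slot p l = Sum.inr m → D l.1 = D m.1) (s t : Fin κ.size) :
    D s = D t := by
  cases κ with
  | tetra => exact congrArg D (Subsingleton.elim (α := Fin 1) s t)
  | pillow c =>
    -- The labels other than `0` and `c.succ` carry the two internal edges of the resolved pillow.
    have hc : ∀ c : Fin 3, ∃ i : Fin 4, i ≠ 0 ∧ i ≠ c.succ := by decide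
    obtain ⟨i, hi, hic⟩ := hc c
    have h01 : D (0 : Fin 2) = D (1 : Fin 2) :=
      hD ((0 : Fin 2), i) ((1 : Fin 2), i) (by simp [VertexKind.slot, hi, hic])
    have key : ∀ s : Fin 2, D s = D (0 : Fin 2) := by
      intro s
      fin_cases s
      · rfl
      · exact h01.symm
    exact (key s).trans (key t).symm
  | double =>
    have hc : ∀ c : Fin 3, ∃ i : Fin 4, i ≠ 0 ∧ i ≠ c.succ := by decide
    obtain ⟨i, hi, hic⟩ := hc p.1.1
    obtain ⟨j, hj, hjc⟩ := hc p.1.2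
    have h01 : D (0 : Fin 4) = D (1 : Fin 4) :=
      hD ((0 : Fin 4), i) ((1 : Fin 4), i) (by simp [VertexKind.slot, hi, hic])
    have h02 : D (0 : Fin 4) = D (2 : Fin 4) :=
      hD ((0 : Fin 4), p.1.1.succ) ((2 : Fin 4), (0 : Fin 4)) (by simp [VertexKind.slot])
    have h23 : D (2 : Fin 4) = D (3 : Fin 4) :=
      hD ((2 : Fin 4), j) ((3 : Fin 4), j) (by simp [VertexKind.slot, hj, hjc])
    have key : ∀ s : Fin 4, D s = D (0 : Fin 4) := by
      intro s
      fin_cases s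
      · rfl
      · exact h01.symm
      · exact h02.symm
      · exact (h02.trans h23).symm
    exact (key s).trans (key t).symm

theorem _root_.CTKT.VertexKind.size_pos (κ : VertexKind) : 0 < κ.size := by
  cases κ <;> simp [VertexKind.size]

theorem component_refine_eq (G : Graph.{u}) (r : G.V → ColorPair) (v : G.V)
    (s t : Fin (G.kind v).size) : (G.refine r).component ⟨v, s⟩ = (G.refine r).component ⟨v, t⟩ := by
  refine (G.kind v).eq_of_slot_eq (r v) (D := fun s => (G.refine r).component ⟨v, s⟩)
    (fun l m h => ?_) s t
  have h1 := (G.refine r).component_edge (G.attach v l)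
  rw [show (G.refine r).edge (G.attach v l) = G.attach v m from G.refineEdge_attach r v l m h] at h1
  exact h1.symm

theorem numVertexComponents_refine (G : Graph.{u}) (r : G.V → ColorPair) :
    (G.refine r).numVertexComponents = G.numVertexComponents := by
  refine Nat.card_congr
    { toFun := liftComponent (fun v => G.component v.1) fun x => ?_
      invFun := liftComponent
        (fun v => (G.refine r).component ⟨v, ⟨0, (G.kind v).size_pos⟩⟩) fun x => ?_
      left_inv := ?_
      right_inv := ?_ }
  · rcases G.outer_or_attach r x with ⟨y, rfl⟩ | ⟨v, l, m, rfl, h⟩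
    · rw [show (G.refine r).edge (G.outer r y) = G.outer r (G.edge y) from G.refineEdge_outer r y]
      exact component_edge y
    · rw [show (G.refine r).edge (G.attach v l) = G.attach v m from G.refineEdge_attach r v l m h]
      rfl
  · have h1 := (G.refine r).component_edge (G.outer r x)
    rw [show (G.refine r).edge (G.outer r x) = G.outer r (G.edge x) from
      G.refineEdge_outer r x] at h1
    exact (G.component_refine_eq r _ _ _).trans (h1.trans (G.component_refine_eq r _ _ _))
  · rintro ⟨⟨v, s⟩⟩
    exact G.component_refine_eq r _ _ _
  · rintro ⟨v⟩
    rfl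

end Graph

theorem matching_mem_iff : ∀ (c : Fin 3) (i : Fin 4),
    (matching c i = 0 ∨ matching c i = c.succ) ↔ (i = 0 ∨ i = c.succ) := by decide

theorem eq_or_eq_matching : ∀ (c : Fin 3) (i j : Fin 4),
    ((i = 0 ∨ i = c.succ) ↔ (j = 0 ∨ j = c.succ)) → i = j ∨ i = matching c j := by decide

namespace Graph

variable {G : Graph.{u}}

/-! ### Isomorphisms -/

theorem Iso.numVertexComponents_eq {G G' : Graph.{u}} (h : G.Iso G') :
    G.numVertexComponents = G'.numVertexComponents := by
  obtain ⟨φ, ψ, h1, -, h3, -, -⟩ := h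
  have key : ∀ x, φ (G.edge x).1 = (G'.edge (ψ x)).1 := fun x => by rw [← h1, h3]
  have key' : ∀ x, φ.symm (G'.edge x).1 = (G.edge (ψ.symm x)).1 := fun x => by
    rw [Equiv.symm_apply_eq, key, Equiv.apply_symm_apply]
  refine Nat.card_congr
    { toFun := liftComponent (fun v => G'.component (φ v)) fun x => ?_
      invFun := liftComponent (fun v => G.component (φ.symm v)) fun x => ?_
      left_inv := ?_
      right_inv := ?_ }
  · rw [key, component_edge, h1]
  · rw [key', component_edge, (Equiv.eq_symm_apply φ).2 (h1 (ψ.symm x)).symm,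
      Equiv.apply_symm_apply]
  · rintro ⟨v⟩
    exact congrArg G.component (φ.symm_apply_apply v)
  · rintro ⟨v⟩
    exact congrArg G'.component (φ.apply_symm_apply v)

theorem Iso.card_face_eq {G G' : Graph.{u}} (h : G.Iso G') (c : Fin 3) :
    Nat.card (G.Face c) = Nat.card (G'.Face c) := by
  obtain ⟨φ, ψ, -, -, h3, h4, -⟩ := h
  refine Nat.card_congr (Quot.congr ψ fun x y => ?_)
  rw [← h3, ← h4, ψ.injective.eq_iff, ψ.injective.eq_iff]

theorem Iso.defect_eq {G G' : Graph.{u}} (h : G.Iso G') : G.defect = G'.defect := by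
  simp only [defect, h.numVertexComponents_eq, h.card_face_eq]
  obtain ⟨φ, -⟩ := h
  rw [Nat.card_congr φ]

/-! ### Insertions -/

section InsertEdge

variable (G) (h : G.V × Fin 4)

/-- An old half-edge, after the insertion. -/
def oldHalf (x : G.V × Fin 4) : (G.insertEdge h).V × Fin 4 := (Sum.inl x.1, x.2)

/-- A half-edge of the inserted vertices. -/
def newHalf (b : Bool) (i : Fin 4) : (G.insertEdge h).V × Fin 4 := (Sum.inr b, i)

theorem eq_oldHalf_or_newHalf (x : (G.insertEdge h).V × Fin 4) :
    (∃ y, x = G.oldHalf h y) ∨ ∃ b i, x = G.newHalf h b i := by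
  obtain ⟨v | b, i⟩ := x
  · exact Or.inl ⟨(v, i), rfl⟩
  · exact Or.inr ⟨b, i, rfl⟩

theorem edge_oldHalf_self : (G.insertEdge h).edge (G.oldHalf h h) = G.newHalf h false 0 := by
  simp [insertEdge, oldHalf, newHalf]

theorem edge_oldHalf_edge :
    (G.insertEdge h).edge (G.oldHalf h (G.edge h)) = G.newHalf h true 0 := by
  simp [insertEdge, oldHalf, newHalf, G.edge_ne h]

theorem edge_oldHalf {x : G.V × Fin 4} (h1 : x ≠ h) (h2 : x ≠ G.edge h) :
    (G.insertEdge h).edge (G.oldHalf h x) = G.oldHalf h (G.edge x) := by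
  simp [insertEdge, oldHalf, h1, h2]

theorem edge_newHalf (b : Bool) {i : Fin 4} (hi : i ≠ 0) :
    (G.insertEdge h).edge (G.newHalf h b i) = G.newHalf h (!b) i := by
  simp [insertEdge, newHalf, hi]

theorem edge_newHalf_false : (G.insertEdge h).edge (G.newHalf h false 0) = G.oldHalf h h :=
  edge_eq_comm.1 (G.edge_oldHalf_self h)

theorem edge_newHalf_true :
    (G.insertEdge h).edge (G.newHalf h true 0) = G.oldHalf h (G.edge h) :=
  edge_eq_comm.1 (G.edge_oldHalf_edge h)

theorem corner_oldHalf (c : Fin 3) (x : G.V × Fin 4) :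
    (G.insertEdge h).corner c (G.oldHalf h x) = G.oldHalf h (G.corner c x) := rfl

theorem corner_newHalf (c : Fin 3) (b : Bool) (i : Fin 4) :
    (G.insertEdge h).corner c (G.newHalf h b i) = G.newHalf h b (matching c i) := rfl

/-- To be constant along the edges of `G.insertEdge h`, it is enough to be so on the old edges,
on the two halves of the cut edge and on the three new edges. -/
theorem insertEdge_invariant {α : Type*} {D : (G.insertEdge h).V × Fin 4 → α}
    (h1 : ∀ x, D (G.oldHalf h (G.edge x)) = D (G.oldHalf h x))
    (h2 : ∀ b, D (G.newHalf h b 0) = D (G.oldHalf h h))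
    (h3 : ∀ i, i ≠ 0 → D (G.newHalf h true i) = D (G.newHalf h false i)) (x) :
    D ((G.insertEdge h).edge x) = D x := by
  rcases G.eq_oldHalf_or_newHalf h x with ⟨y, rfl⟩ | ⟨b, i, rfl⟩
  · by_cases e1 : y = h
    · rw [e1, edge_oldHalf_self, h2]
    · by_cases e2 : y = G.edge h
      · rw [e2, edge_oldHalf_edge, h2, h1]
      · rw [edge_oldHalf _ _ e1 e2, h1]
  · by_cases hi : i = 0
    · subst hi
      cases b
      · rw [edge_newHalf_false, h2]
      · rw [edge_newHalf_true, h2, h1]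
    · rw [edge_newHalf _ _ _ hi]
      cases b
      · exact h3 i hi
      · exact (h3 i hi).symm

/-- A function that is constant along the edges of `G.insertEdge h`, and takes the same value at the
ends of the cut edge, is constant along the edges of `G`. -/
theorem invariant_of_insertEdge {α : Type*} {D : (G.insertEdge h).V × Fin 4 → α}
    (hD : ∀ x, D ((G.insertEdge h).edge x) = D x)
    (h0 : D (G.newHalf h true 0) = D (G.newHalf h false 0)) (x : G.V × Fin 4) :
    D (G.oldHalf h (G.edge x)) = D (G.oldHalf h x) := by
  have h1 : D (G.oldHalf h (G.edge h)) = D (G.oldHalf h h) := by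
    rw [← edge_newHalf_true, hD, h0, ← hD, edge_newHalf_false]
  by_cases e1 : x = h
  · rw [e1, h1]
  · by_cases e2 : x = G.edge h
    · rw [e2, G.edge_edge, h1]
    · rw [← edge_oldHalf _ _ e1 e2, hD]

/-- On the two new vertices, colour `c` has only two strands: the labels `0` and `c.succ` prolong
the face through the cut edge, and the other two labels bound a new face of length two. -/
theorem face_newHalf (c : Fin 3) (i j : Fin 4)
    (hij : (i = 0 ∨ i = c.succ) ↔ (j = 0 ∨ j = c.succ)) (b b' : Bool) :
    (G.insertEdge h).face c (G.newHalf h b i) = (G.insertEdge h).face c (G.newHalf h b' j) := by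
  have h1 : ∀ b i, (G.insertEdge h).face c (G.newHalf h b (matching c i))
      = (G.insertEdge h).face c (G.newHalf h b i) := fun b i => by
    rw [← corner_newHalf, face_corner]
  have h2 : ∀ b i, i ≠ 0 → (G.insertEdge h).face c (G.newHalf h (!b) i)
      = (G.insertEdge h).face c (G.newHalf h b i) := fun b i hi => by
    rw [← G.edge_newHalf h b hi, face_edge]
  have h3 : ∀ b i, (G.insertEdge h).face c (G.newHalf h (!b) i)
      = (G.insertEdge h).face c (G.newHalf h b i) := by
    intro b i
    by_cases hi : i = 0
    · subst hi
      rw [← h1, h2 _ _ (matching_ne c 0), h1]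
    · exact h2 b i hi
  have h4 : (G.insertEdge h).face c (G.newHalf h b i)
      = (G.insertEdge h).face c (G.newHalf h b j) := by
    rcases eq_or_eq_matching c i j hij with rfl | rfl
    · rfl
    · exact h1 _ _
  rw [h4]
  cases b <;> cases b'
  · rfl
  · exact (h3 false j).symm
  · exact (h3 true j).symm
  · rfl

theorem numVertexComponents_insertEdge :
    (G.insertEdge h).numVertexComponents = G.numVertexComponents := by
  have hcomp : ∀ x, (G.insertEdge h).component ((G.insertEdge h).edge x).1
      = (G.insertEdge h).component x.1 := component_edge
  have e3 : (G.insertEdge h).component (G.newHalf h true 0).1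
      = (G.insertEdge h).component (G.newHalf h false 0).1 := by
    have := hcomp (G.newHalf h false 1)
    rwa [edge_newHalf _ _ _ (by decide)] at this
  have e1 : (G.insertEdge h).component (G.newHalf h false 0).1
      = (G.insertEdge h).component (G.oldHalf h h).1 := by
    rw [← edge_oldHalf_self, hcomp]
  exact Nat.card_congr
    { toFun := liftComponent (Sum.elim G.component fun _ => G.component h.1)
        (G.insertEdge_invariant h
          (D := fun x => Sum.elim G.component (fun _ => G.component h.1) x.1)
          (fun x => component_edge x) (fun _ => rfl) fun _ _ => rfl)
      invFun := liftComponent (fun v => (G.insertEdge h).component (G.oldHalf h (v, 0)).1) fun x =>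
        G.invariant_of_insertEdge h (D := fun x => (G.insertEdge h).component x.1) hcomp e3 x
      left_inv := by
        rintro ⟨v | b⟩
        · rfl
        · cases b
          · exact e1.symm
          · exact (e3.trans e1).symm
      right_inv := by
        rintro ⟨v⟩
        rfl }

theorem card_face_insertEdge (c : Fin 3) :
    Nat.card ((G.insertEdge h).Face c) = Nat.card (G.Face c) + 1 := by
  classical
  rw [← Finite.card_option]
  have hc : ∀ c : Fin 3, ∃ i : Fin 4, ¬ (i = 0 ∨ i = c.succ) := by decide
  obtain ⟨j, hj⟩ := hc c
  have hin := G.face_newHalf h c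
  have e1 : (G.insertEdge h).face c (G.newHalf h false 0)
      = (G.insertEdge h).face c (G.oldHalf h h) := by
    rw [← edge_oldHalf_self, face_edge]
  -- `none` stands for the new face of length two.
  let D : (G.insertEdge h).V × Fin 4 → Option (G.Face c) := fun x =>
    Sum.elim (fun v => some (G.face c (v, x.2)))
      (fun _ => if x.2 = 0 ∨ x.2 = c.succ then some (G.face c h) else none) x.1
  have hnew : ∀ b i, D (G.newHalf h b i)
      = if i = 0 ∨ i = c.succ then some (G.face c h) else none := fun _ _ => rfl
  have hcor : ∀ x, D ((G.insertEdge h).corner c x) = D x := by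
    intro x
    rcases G.eq_oldHalf_or_newHalf h x with ⟨y, rfl⟩ | ⟨b, i, rfl⟩
    · exact congrArg some (face_corner c y)
    · rw [corner_newHalf, hnew, hnew]
      simp only [matching_mem_iff]
  let E : Option (G.Face c) → (G.insertEdge h).Face c := fun f =>
    f.elim ((G.insertEdge h).face c (G.newHalf h false j))
      (liftFace c (fun x => (G.insertEdge h).face c (G.oldHalf h x))
        (fun x => by rw [← corner_oldHalf, face_corner])
        (G.invariant_of_insertEdge h (face_edge c) (hin 0 0 Iff.rfl true false)))
  exact Nat.card_congr
    { toFun := liftFace c D hcor (G.insertEdge_invariant h (fun x => congrArg some (face_edge c x))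
        (fun b => (hnew b 0).trans (if_pos (Or.inl rfl))) fun _ _ => rfl)
      invFun := E
      left_inv := by
        intro f
        obtain ⟨x, rfl⟩ := (G.insertEdge h).face_surjective f
        change E (D x) = _
        rcases G.eq_oldHalf_or_newHalf h x with ⟨y, rfl⟩ | ⟨b, i, rfl⟩
        · rfl
        · rw [hnew]
          by_cases hi : i = 0 ∨ i = c.succ
          · rw [if_pos hi]
            exact e1.symm.trans (hin _ _ (by simp [hi]) _ _)
          · rw [if_neg hi]
            exact hin _ _ (by simp [hi, hj]) _ _
      right_inv := by
        rintro (_ | ⟨⟨v, i⟩⟩)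
        · exact if_neg hj
        · rfl }

/-- Two vertices and one face of each colour contribute 3·2 - 2·3 = 0. -/
theorem defect_insertEdge : (G.insertEdge h).defect = G.defect := by
  have : Nat.card (G.insertEdge h).V = Nat.card G.V + 2 := by
    change Nat.card (G.V ⊕ Bool) = _
    rw [Nat.card_sum, Nat.card_eq_fintype_card (α := Bool), Fintype.card_bool]
  simp only [defect, numVertexComponents_insertEdge, card_face_insertEdge, this,
    Fin.sum_univ_three]
  push_cast
  ring

end InsertEdge

section InsertRing

variable (G)

theorem numVertexComponents_insertRing :
    G.insertRing.numVertexComponents = G.numVertexComponents + 1 := by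
  rw [numVertexComponents, numVertexComponents, ← Finite.card_option]
  refine Nat.card_congr
    { toFun := liftComponent (Sum.elim (fun v => some (G.component v)) fun _ => none) ?_
      invFun := fun q => q.elim (G.insertRing.component (Sum.inr false))
        (liftComponent (fun v => G.insertRing.component (Sum.inl v)) fun x =>
          G.insertRing.component_edge (Sum.inl x.1, x.2))
      left_inv := ?_
      right_inv := ?_ }
  · rintro ⟨v | b, i⟩
    · exact congrArg some (component_edge (v, i))
    · rfl
  · rintro ⟨v | b⟩
    · rfl
    · cases b
      · rfl
      · exact G.insertRing.component_edge (Sum.inr true, 0)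
  · rintro (_ | ⟨⟨v⟩⟩) <;> rfl

theorem card_face_insertRing (c : Fin 3) :
    Nat.card (G.insertRing.Face c) = Nat.card (G.Face c) + 2 := by
  have hB : Nat.card (G.Face c ⊕ Bool) = Nat.card (G.Face c) + 2 := by
    rw [Nat.card_sum, Nat.card_eq_fintype_card (α := Bool), Fintype.card_bool]
  rw [← hB]
  have hc : ∀ c : Fin 3, ∃ i : Fin 4, ¬ (i = 0 ∨ i = c.succ) := by decide
  obtain ⟨j, hj⟩ := hc c
  -- The two booleans are the two new faces of colour `c`, on the labels `0`, `c.succ` and on the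
  -- two others.
  let D : G.insertRing.V × Fin 4 → G.Face c ⊕ Bool := fun x =>
    Sum.elim (fun v => Sum.inl (G.face c (v, x.2)))
      (fun _ => Sum.inr (decide (x.2 = 0 ∨ x.2 = c.succ))) x.1
  have hin : ∀ (b b' : Bool) (i j : Fin 4), ((i = 0 ∨ i = c.succ) ↔ (j = 0 ∨ j = c.succ)) →
      G.insertRing.face c (Sum.inr b, i) = G.insertRing.face c (Sum.inr b', j) := by
    intro b b' i j hij
    have h1 : G.insertRing.face c (Sum.inr b, i) = G.insertRing.face c (Sum.inr b, j) := by
      rcases eq_or_eq_matching c i j hij with rfl | rfl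
      · rfl
      · exact face_corner (G := G.insertRing) c (Sum.inr b, j)
    rw [h1]
    by_cases hb : b = b'
    · rw [hb]
    · obtain rfl : b = !b' := by cases b <;> cases b' <;> simp_all
      exact face_edge (G := G.insertRing) c (Sum.inr b', j)
  refine Nat.card_congr
    { toFun := liftFace c D ?_ ?_
      invFun := Sum.elim
        (liftFace c (fun x => G.insertRing.face c (Sum.inl x.1, x.2))
          (fun x => face_corner (G := G.insertRing) c (Sum.inl x.1, x.2))
          fun x => face_edge (G := G.insertRing) c (Sum.inl x.1, x.2))
        fun b => G.insertRing.face c (Sum.inr false, if b then 0 else j)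
      left_inv := ?_
      right_inv := ?_ }
  · rintro ⟨v | b, i⟩
    · exact congrArg Sum.inl (face_corner c (v, i))
    · change Sum.inr (decide (matching c i = 0 ∨ matching c i = c.succ))
        = Sum.inr (decide (i = 0 ∨ i = c.succ))
      simp only [matching_mem_iff]
  · rintro ⟨v | b, i⟩
    · exact congrArg Sum.inl (face_edge c (v, i))
    · rfl
  · rintro ⟨⟨v | b, i⟩⟩
    · rfl
    · refine hin _ _ _ _ ?_
      by_cases hi : i = 0 ∨ i = c.succ <;> simp [hi, hj]
  · rintro (⟨⟨v, i⟩⟩ | b)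
    · rfl
    · change Sum.inr (decide ((if b then 0 else j) = 0 ∨ (if b then 0 else j) = c.succ)) = Sum.inr b
      cases b
      · simpa using hj
      · simp

/-- One component, two vertices and two faces of each colour contribute 6 + 3·2 - 2·6 = 0. -/
theorem defect_insertRing : G.insertRing.defect = G.defect := by
  have : Nat.card G.insertRing.V = Nat.card G.V + 2 := by
    change Nat.card (G.V ⊕ Bool) = _
    rw [Nat.card_sum, Nat.card_eq_fintype_card (α := Bool), Fintype.card_bool]
  simp only [defect, numVertexComponents_insertRing, card_face_insertRing, this,
    Fin.sum_univ_three]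
  push_cast
  ring

end InsertRing

/-! ### Melonic graphs have defect zero -/

theorem numVertexComponents_eq_zero [IsEmpty G.V] : G.numVertexComponents = 0 := by
  have : IsEmpty (Quot fun v w : G.V => ∃ i j : Fin 4, G.edge (v, i) = (w, j)) :=
    ⟨fun q => isEmptyElim q.exists_rep.choose⟩
  exact Nat.card_of_isEmpty

theorem isEmpty_face [IsEmpty G.V] (c : Fin 3) : IsEmpty (G.Face c) :=
  ⟨fun f => isEmptyElim (G.face_surjective f).choose⟩

theorem defect_eq_zero_of_isEmpty [IsEmpty G.V] : G.defect = 0 := by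
  have := fun c => G.isEmpty_face c
  simp [defect, numVertexComponents_eq_zero]

/-- Melonic graphs have degree zero. -/
theorem IsMelonic.defect_eq_zero (hG : G.IsMelonic) : G.defect = 0 := by
  induction hG with
  | ring =>
    have : IsEmpty Graph.ring.{u}.V := inferInstanceAs (IsEmpty PEmpty)
    exact defect_eq_zero_of_isEmpty
  | insertEdge G h _ ih => rw [defect_insertEdge, ih]
  | insertRing G _ _ ih => rw [defect_insertRing, ih]
  | iso G G' h _ ih => rw [← h.defect_eq, ih]

end Graph

/-- The half-edge `i` of a tetrahedral vertex, when `j` is taken as the half-edge `0`. -/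
def shift (i j : Fin 4) : Fin 4 := Fin.cases j (fun d => matching d j) i

/-- The identity and the three matchings form a Klein four-group acting simply transitively on the
labels, and `shift i` is its element that carries `0` to `i`. Relabelling by `shift` therefore
respects all strands, and lets any external half-edge of a melon play the role of the label `0` in
`insertEdge`. -/
theorem shift_matching : ∀ (c : Fin 3) (i j : Fin 4),
    shift (matching c i) j = matching c (shift i j) := by decide

theorem shift_injective : ∀ j i i' : Fin 4, shift i j = shift i' j → i = i' := by decide

theorem exists_shift_eq : ∀ j k : Fin 4, ∃ i, shift i j = k := by decide

namespace Graph

variable {G : Graph.{u}} {x y : G.V × Fin 4}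

theorem Tetrahedral.corner_eq_shift (hT : G.Tetrahedral) (d : Fin 3) (x : G.V × Fin 4) :
    G.corner d x = (x.1, shift d.succ x.2) := hT.corner_eq d x

/-! ### Removal of a melon -/

namespace IsMelon

theorem symm (hm : G.IsMelon x y) : G.IsMelon y x :=
  ⟨hm.1.symm, fun c => edge_eq_comm.1 (hm.2 c)⟩

theorem edge_fst_ne_left (hm : G.IsMelon x y) (hT : G.Tetrahedral) : (G.edge x).1 ≠ x.1 := by
  intro h
  rcases hT.eq_or_corner h with h | ⟨c, h⟩
  · exact G.edge_ne x h
  · have := hm.2 c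
    rw [← h, G.edge_edge] at this
    exact hm.1 (congrArg Prod.fst this :)

theorem edge_fst_ne_right (hm : G.IsMelon x y) (hT : G.Tetrahedral) (hxy : G.edge x ≠ y) :
    (G.edge x).1 ≠ y.1 := by
  intro h
  rcases hT.eq_or_corner h with h | ⟨c, h⟩
  · exact hxy h
  · rw [edge_eq_comm, hm.symm.2 c] at h
    exact G.corner_ne c x h

theorem edge_eq_of_fst_eq (hm : G.IsMelon x y) (hT : G.Tetrahedral) {z : G.V × Fin 4}
    (hz : z.1 ≠ y.1) (h : (G.edge z).1 = x.1) : G.edge z = x := by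
  rcases hT.eq_or_corner h with h | ⟨c, h⟩
  · exact h
  · rw [edge_eq_comm, hm.2 c] at h
    exact absurd (congrArg Prod.fst h.symm) hz

/-- With its four half-edges joined to one another, a melon is a component. -/
theorem iso_insertRing_ring (hm : G.IsMelon x y) (hT : G.Tetrahedral)
    (hG : G.numVertexComponents = 1) (hr : G.rings = 0) (hxy : G.edge x = y) :
    Iso (insertRing ring) G := by
  have hall : ∀ v, v = x.1 ∨ v = y.1 := by
    refine mem_of_edge_closed hG (K := fun v => v = x.1 ∨ v = y.1) ?_ (Or.inl rfl)
    rintro z (hz | hz)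
    · rcases hT.eq_or_corner hz with rfl | ⟨c, rfl⟩
      · exact Or.inr (congrArg Prod.fst hxy)
      · exact Or.inr (congrArg Prod.fst (hm.2 c) :)
    · rcases hT.eq_or_corner hz with rfl | ⟨c, rfl⟩
      · exact Or.inl (congrArg Prod.fst (edge_eq_comm.1 hxy))
      · exact Or.inl (congrArg Prod.fst (hm.symm.2 c) :)
  let e : Bool → G.V × Fin 4 := fun b => if b then y else x
  have he : ∀ b b', (e b).1 = (e b').1 → b = b' := by
    intro b b' h
    cases b <;> cases b'
    · rfl
    · exact absurd h hm.1
    · exact absurd h.symm hm.1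
    · rfl
  have he' : ∀ v, ∃ b, (e b).1 = v := by
    intro v
    rcases hall v with rfl | rfl
    · exact ⟨false, rfl⟩
    · exact ⟨true, rfl⟩
  let φ : (insertRing ring.{u}).V → G.V := Sum.elim (fun p => p.elim) fun b => (e b).1
  let ψ : (insertRing ring.{u}).V × Fin 4 → G.V × Fin 4 := fun z =>
    Sum.elim (fun p => p.elim) (fun b => ((e b).1, shift z.2 (e b).2)) z.1
  have hφ : Function.Bijective φ := by
    refine ⟨?_, fun v => ?_⟩
    · rintro (⟨⟨⟩⟩ | b) (⟨⟨⟩⟩ | b') h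
      exact congrArg Sum.inr (he b b' h)
    · obtain ⟨b, hb⟩ := he' v
      exact ⟨Sum.inr b, hb⟩
  have hψ : Function.Bijective ψ := by
    refine ⟨?_, fun z => ?_⟩
    · rintro ⟨⟨⟨⟩⟩ | b, i⟩ ⟨⟨⟨⟩⟩ | b', i'⟩ h
      obtain rfl := he b b' (congrArg Prod.fst h :)
      obtain rfl := shift_injective _ _ _ (congrArg Prod.snd h)
      rfl
    · obtain ⟨b, hb⟩ := he' z.1
      obtain ⟨i, hi⟩ := exists_shift_eq (e b).2 z.2
      exact ⟨(Sum.inr b, i), Prod.ext hb hi⟩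
  refine ⟨Equiv.ofBijective φ hφ, Equiv.ofBijective ψ hψ, ?_, fun v => ?_, ?_, ?_, hr.symm⟩
  · rintro ⟨⟨⟨⟩⟩ | b, i⟩
    rfl
  · rw [hT]
    obtain ⟨⟨⟩⟩ | b := v
    rfl
  · rintro ⟨⟨⟨⟩⟩ | b, i⟩
    change ((e !b).1, shift i (e !b).2) = G.edge ((e b).1, shift i (e b).2)
    induction i using Fin.cases with
    | zero =>
      cases b
      · exact hxy.symm
      · exact (edge_eq_comm.1 hxy).symm
    | succ d =>
      rw [← hT.corner_eq_shift, ← hT.corner_eq_shift]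
      cases b
      · exact (hm.2 d).symm
      · exact (hm.symm.2 d).symm
  · rintro c ⟨⟨⟨⟩⟩ | b, i⟩
    rw [hT.corner_eq]
    exact Prod.ext rfl (shift_matching c i _)

end IsMelon

open Classical in
/-- The other end of the edge of `z` once the melon between `x` and `y` has been removed. -/
noncomputable def bypass (G : Graph.{u}) (x y z : G.V × Fin 4) : G.V × Fin 4 :=
  if G.edge z = x then G.edge y else if G.edge z = y then G.edge x else G.edge z

theorem bypass_of_ne {z : G.V × Fin 4} (h1 : G.edge z ≠ x) (h2 : G.edge z ≠ y) :
    G.bypass x y z = G.edge z := by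
  rw [bypass, if_neg h1, if_neg h2]

theorem bypass_edge_left : G.bypass x y (G.edge x) = G.edge y := by
  rw [bypass, if_pos (G.edge_edge x)]

theorem bypass_edge_right (h : x.1 ≠ y.1) : G.bypass x y (G.edge y) = G.edge x := by
  rw [bypass, G.edge_edge, if_neg (fun e => h (congrArg Prod.fst e.symm)), if_pos rfl]

theorem bypass_cases (h : x.1 ≠ y.1) (z : G.V × Fin 4) :
    (z = G.edge x ∧ G.bypass x y z = G.edge y) ∨ (z = G.edge y ∧ G.bypass x y z = G.edge x) ∨
      (G.edge z ≠ x ∧ G.edge z ≠ y ∧ G.bypass x y z = G.edge z) := by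
  by_cases h1 : G.edge z = x
  · obtain rfl := edge_eq_comm.1 h1
    exact Or.inl ⟨rfl, bypass_edge_left⟩
  · by_cases h2 : G.edge z = y
    · obtain rfl := edge_eq_comm.1 h2
      exact Or.inr (Or.inl ⟨rfl, bypass_edge_right h⟩)
    · exact Or.inr (Or.inr ⟨h1, h2, bypass_of_ne h1 h2⟩)

/-- A melon meets the rest of the graph only through `x` and `y`; as these are not joined to each
other, their edges end outside the melon. -/
theorem IsMelon.bypass_fst (hm : G.IsMelon x y) (hT : G.Tetrahedral) (hxy : G.edge x ≠ y)
    {z : G.V × Fin 4} (h1 : z.1 ≠ x.1) (h2 : z.1 ≠ y.1) :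
    (G.bypass x y z).1 ≠ x.1 ∧ (G.bypass x y z).1 ≠ y.1 := by
  have hyx : G.edge y ≠ x := fun h => hxy (edge_eq_comm.1 h)
  rcases bypass_cases hm.1 z with ⟨-, h⟩ | ⟨-, h⟩ | ⟨h3, h4, h⟩ <;> rw [h]
  · exact ⟨hm.symm.edge_fst_ne_right hT hyx, hm.symm.edge_fst_ne_left hT⟩
  · exact ⟨hm.edge_fst_ne_left hT, hm.edge_fst_ne_right hT hxy⟩
  · exact ⟨fun h => h3 (hm.edge_eq_of_fst_eq hT h2 h),
      fun h => h4 (hm.symm.edge_eq_of_fst_eq hT h1 h)⟩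

/-- The removal of a melon, whose external half-edges are not joined to each other. -/
noncomputable def removeMelon (G : Graph.{u}) {x y : G.V × Fin 4} (hm : G.IsMelon x y)
    (hT : G.Tetrahedral) (hxy : G.edge x ≠ y) : Graph.{u} where
  V := {v : G.V // v ≠ x.1 ∧ v ≠ y.1}
  finite := inferInstance
  kind v := G.kind v.1
  edge z :=
    (⟨(G.bypass x y (z.1.1, z.2)).1, hm.bypass_fst hT hxy z.1.2.1 z.1.2.2⟩,
      (G.bypass x y (z.1.1, z.2)).2)
  edge_edge := by
    rintro ⟨⟨v, hv⟩, i⟩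
    have key : G.bypass x y (G.bypass x y (v, i)) = (v, i) := by
      rcases bypass_cases hm.1 (v, i) with ⟨h', h⟩ | ⟨h', h⟩ | ⟨h3, h4, h⟩ <;> rw [h]
      · rw [h', bypass_edge_right hm.1]
      · rw [h', bypass_edge_left]
      · rw [bypass_of_ne, G.edge_edge]
        · rw [G.edge_edge]
          rintro rfl
          exact hv.1 rfl
        · rw [G.edge_edge]
          rintro rfl
          exact hv.2 rfl
    exact Prod.ext (Subtype.ext (congrArg Prod.fst key)) (congrArg Prod.snd key :)
  edge_ne := by
    rintro ⟨⟨v, hv⟩, i⟩ h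
    have key : G.bypass x y (v, i) = (v, i) :=
      Prod.ext (congrArg (fun z => z.1.1) h) (congrArg (fun z => z.2) h)
    have hne : G.edge x ≠ G.edge y := fun h =>
      hm.1 (congrArg Prod.fst (G.edge_involutive.injective h))
    rcases bypass_cases hm.1 (v, i) with ⟨h', h⟩ | ⟨h', h⟩ | ⟨h3, h4, h⟩
    · rw [h, h'] at key
      exact hne key.symm
    · rw [h, h'] at key
      exact hne key
    · rw [h] at key
      exact G.edge_ne _ key
  rings := G.rings

namespace IsMelon

theorem exists_iso_insertEdge (hm : G.IsMelon x y) (hT : G.Tetrahedral) (hxy : G.edge x ≠ y) :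
    ∃ h, Iso ((G.removeMelon hm hT hxy).insertEdge h) G := by
  have hex : (G.edge x).1 ≠ x.1 ∧ (G.edge x).1 ≠ y.1 :=
    ⟨hm.edge_fst_ne_left hT, hm.edge_fst_ne_right hT hxy⟩
  let R := G.removeMelon hm hT hxy
  let h : R.V × Fin 4 := (⟨(G.edge x).1, hex⟩, (G.edge x).2)
  let incl : R.V × Fin 4 → G.V × Fin 4 := fun z => (z.1.1, z.2)
  have hincl : Function.Injective incl := fun z w e =>
    Prod.ext (Subtype.ext (congrArg (fun z => z.1) e)) (congrArg (fun z => z.2) e)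
  have hedge : ∀ z, incl (R.edge z) = G.bypass x y (incl z) := fun z => rfl
  have hh : incl h = G.edge x := rfl
  have hh' : incl (R.edge h) = G.edge y := by rw [hedge, hh, bypass_edge_left]
  let e : Bool → G.V × Fin 4 := fun b => if b then y else x
  have he : ∀ b b', (e b).1 = (e b').1 → b = b' := by
    intro b b' h
    cases b <;> cases b'
    · rfl
    · exact absurd h hm.1
    · exact absurd h.symm hm.1
    · rfl
  have hmem : ∀ (v : R.V) (b : Bool), v.1 ≠ (e b).1 := by
    intro v b
    cases b
    · exact v.2.1
    · exact v.2.2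
  have hcover : ∀ v, (∃ b, (e b).1 = v) ∨ (v ≠ x.1 ∧ v ≠ y.1) := by
    intro v
    by_cases h1 : v = x.1
    · exact Or.inl ⟨false, h1.symm⟩
    · by_cases h2 : v = y.1
      · exact Or.inl ⟨true, h2.symm⟩
      · exact Or.inr ⟨h1, h2⟩
  let φ : (R.insertEdge h).V → G.V := Sum.elim (fun v => v.1) fun b => (e b).1
  let ψ : (R.insertEdge h).V × Fin 4 → G.V × Fin 4 := fun z =>
    Sum.elim (fun v => (v.1, z.2)) (fun b => ((e b).1, shift z.2 (e b).2)) z.1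
  have hψo : ∀ z, ψ (R.oldHalf h z) = incl z := fun _ => rfl
  have hψn : ∀ b i, ψ (R.newHalf h b i) = ((e b).1, shift i (e b).2) := fun _ _ => rfl
  have hφ : Function.Bijective φ := by
    refine ⟨?_, fun v => ?_⟩
    · rintro (v | b) (v' | b') h
      · exact congrArg Sum.inl (Subtype.ext h)
      · exact absurd h (hmem v b')
      · exact absurd h.symm (hmem v' b)
      · exact congrArg Sum.inr (he b b' h)
    · rcases hcover v with ⟨b, hb⟩ | hv
      · exact ⟨Sum.inr b, hb⟩
      · exact ⟨Sum.inl ⟨v, hv⟩, rfl⟩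
  have hψ : Function.Bijective ψ := by
    refine ⟨?_, fun z => ?_⟩
    · intro z w hzw
      rcases R.eq_oldHalf_or_newHalf h z with ⟨z, rfl⟩ | ⟨b, i, rfl⟩ <;>
        rcases R.eq_oldHalf_or_newHalf h w with ⟨w, rfl⟩ | ⟨b', i', rfl⟩
      · rw [hincl hzw]
      · exact absurd (congrArg Prod.fst hzw) (hmem z.1 b')
      · exact absurd (congrArg Prod.fst hzw).symm (hmem w.1 b)
      · obtain rfl := he b b' (congrArg Prod.fst hzw :)
        obtain rfl := shift_injective _ _ _ (congrArg Prod.snd hzw)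
        rfl
    · rcases hcover z.1 with ⟨b, hb⟩ | hv
      · obtain ⟨i, hi⟩ := exists_shift_eq (e b).2 z.2
        exact ⟨R.newHalf h b i, Prod.ext hb hi⟩
      · exact ⟨R.oldHalf h (⟨z.1, hv⟩, z.2), rfl⟩
  refine ⟨h, Equiv.ofBijective φ hφ, Equiv.ofBijective ψ hψ, ?_, ?_, ?_, ?_, rfl⟩
  · rintro ⟨v | b, i⟩ <;> rfl
  · rintro (v | b)
    · rfl
    · exact hT _
  · intro z
    change ψ ((R.insertEdge h).edge z) = G.edge (ψ z)
    rcases R.eq_oldHalf_or_newHalf h z with ⟨z, rfl⟩ | ⟨b, i, rfl⟩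
    · by_cases e1 : z = h
      · rw [e1, edge_oldHalf_self, hψo, hh, G.edge_edge]
        rfl
      · by_cases e2 : z = R.edge h
        · rw [e2, edge_oldHalf_edge, hψo, hh', G.edge_edge]
          rfl
        · rw [edge_oldHalf _ _ e1 e2, hψo, hψo, hedge, bypass_of_ne]
          · exact fun h3 => e1 (hincl ((edge_eq_comm.1 h3).symm.trans hh.symm))
          · exact fun h3 => e2 (hincl ((edge_eq_comm.1 h3).symm.trans hh'.symm))
    · induction i using Fin.cases with
      | zero =>
        cases b
        · rw [edge_newHalf_false]
          rfl
        · rw [edge_newHalf_true, hψo, hh']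
          rfl
      | succ d =>
        rw [edge_newHalf _ _ _ (Fin.succ_ne_zero d), hψn, hψn, ← hT.corner_eq_shift,
          ← hT.corner_eq_shift]
        cases b
        · exact (hm.2 d).symm
        · exact (hm.symm.2 d).symm
  · intro c z
    change ψ ((R.insertEdge h).corner c z) = G.corner c (ψ z)
    rcases R.eq_oldHalf_or_newHalf h z with ⟨z, rfl⟩ | ⟨b, i, rfl⟩
    · rfl
    · rw [corner_newHalf, hψn, hψn, hT.corner_eq, shift_matching]

end IsMelon

/-- A connected graph of degree zero with only tetrahedral vertices is melonic. -/
theorem Tetrahedral.isMelonic : ∀ (n : ℕ) {G : Graph.{u}}, Nat.card G.V = n → G.Tetrahedral →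
    G.numVertexComponents + G.rings = 1 → G.defect = 0 → G.IsMelonic := by
  intro n
  induction n using Nat.strong_induction_on with
  | _ n ih =>
    intro G hn hT hG hd
    rcases isEmpty_or_nonempty G.V with hV | hV
    · rw [numVertexComponents_eq_zero, zero_add] at hG
      have : IsEmpty Graph.ring.{u}.V := inferInstanceAs (IsEmpty PEmpty)
      exact .iso _ _ ⟨Equiv.equivOfIsEmpty _ _, Equiv.equivOfIsEmpty _ _, isEmptyElim,
        isEmptyElim, isEmptyElim, fun _ => isEmptyElim, hG.symm⟩ .ring
    · have h1 : 0 < G.numVertexComponents := by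
        have : Nonempty (Quot fun v w : G.V => ∃ i j : Fin 4, G.edge (v, i) = (w, j)) :=
          hV.map G.component
        exact Nat.card_pos
      have hc : G.numVertexComponents = 1 := by omega
      obtain ⟨x, y, hm⟩ := exists_isMelon hT hc (hT.planarJackets hc hd)
      by_cases hxy : G.edge x = y
      -- A melon closed on itself is the whole connected graph.
      · exact .iso _ _ (hm.iso_insertRing_ring hT hc (by omega) hxy)
          (.insertRing _ Nat.one_pos .ring)
      · obtain ⟨h, hiso⟩ := hm.exists_iso_insertEdge hT hxy
        refine .iso _ _ hiso (.insertEdge _ h (ih _ ?_ rfl (fun v => hT v.1) ?_ ?_))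
        · rw [← hn]
          exact Finite.card_subtype_lt (x := x.1) fun h => h.1 rfl
        -- Connectedness and defect of the reduced graph are read off from `G`, which is an
        -- insertion on it up to isomorphism.
        · rw [← numVertexComponents_insertEdge _ h, hiso.numVertexComponents_eq]
          exact hG
        · rw [← defect_insertEdge _ h, hiso.defect_eq, hd]

end Graph

end CTKT

/-! ### The proposition -/

theorem propositionA7 (G : CTKT.Graph.{u}) (hG : G.Connected) (r : G.V → CTKT.ColorPair) :
    (G.degree r = 0 ↔ G.IsMelonTadpole r) ∧
      (G.degree r = 0 → ∀ (c : Fin 3) (f : (G.refine r).Face c),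
        (G.refine r).faceLength c f ≠ 1 ∧ (G.refine r).faceLength c f ≠ 3) := by
  have hT := G.tetrahedral_refine r
  have hc : (G.refine r).numVertexComponents + (G.refine r).rings = 1 := by
    rw [G.numVertexComponents_refine r]
    exact hG
  rw [G.degree_eq_zero_iff r]
  refine ⟨⟨fun hd => ⟨hG, CTKT.Graph.Tetrahedral.isMelonic _ rfl hT hc hd⟩,
    fun h => h.2.defect_eq_zero⟩, fun hd c f => ?_⟩
  -- A face visits a vertex, so the graph is not a ring and the planarity results apply.
  have h1 : 0 < (G.refine r).numVertexComponents := by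
    obtain ⟨x, -⟩ := (G.refine r).face_surjective f
    have : Nonempty (Quot fun v w : (G.refine r).V =>
        ∃ i j : Fin 4, (G.refine r).edge (v, i) = (w, j)) := ⟨(G.refine r).component x.1⟩
    exact Nat.card_pos
  have hc' : (G.refine r).numVertexComponents = 1 := by omega
  have h4 : 4 ∣ Nat.card {x : (G.refine r).V × Fin 4 // (Quot.mk _ x : (G.refine r).Face c) = f} :=
    CTKT.Graph.four_dvd_ncard_face hT hc' (hT.planarJackets hc' hd) c f
  -- The length is half of a multiple of four, hence even.
  rw [CTKT.Graph.faceLength]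
  omega
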